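/- Let $k$ be a field with separable closure $\Omega$; all finite separable extensions $F, L,\dots$ of $k$ are taken inside $\Omega$, and $G_F=\mathrm{Gal}(\Omega/F)$. **(A1)** Let $k_{\rm pur}/k$ be a $\hat{\mathbb Z}$-extension, i.e. a Galois extension inside $\Omega$ with a fixed isomorphism of topological groups $\mathrm{Gal}(k_{\rm pur}/k)\simeq\hat{\mathbb Z}$, $\mathrm{Frob}_k\mapsto 1$. For $F/k$ finite separable put $F_{\rm pur}=Fk_{\rm pur}$, $f_F=|F\cap k_{\rm pur}:k|$, and let $\mathrm{Frob}_F\in\mathrm{Gal}(F_{\rm pur}/F)$ be the automorphism whose restriction to $k_{\rm pur}$ is $\mathrm{Frob}_k^{f_F}$. **(A2)** Let $F\mapsto A_F$ be a cohomological Mackey functor on the finite separable extensions of $k$: abelian groups $A_F$ with homomorphisms $i_{F/L}:A_F\to A_L$ and $N_{L/F}:A_L\to A_F$ for $F\subset L$ and $g:A_F\to A_{gF}$ for $g\in G_k$, such that $i$, $N$ and $g$ are functorial, $g$ commutes with $i$ and $N$, $g\in G_F$ acts trivially on $A_F$, the double coset formula $i_{F/M}N_{L/F}=\sum_{g\in G_M\backslash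 G_F/G_L}N_{M\cdot gL/M}\,i_{gL/M\cdot gL}\,g$ holds, and $N_{L/F}\,i_{F/L}=|L:F|$. Let $\mathfrak v:A_k\to\mathbb Z$ be a surjective homomorphism with $\mathfrak v(N_{L/k}A_L)=|L\cap k_{\rm pur}:k|\,\mathfrak v(A_k)$ for every finite separable $L/k$, and put $\mathfrak v_L=\frac1{|L\cap k_{\rm pur}:k|}\,\mathfrak v\circ N_{L/k}:A_L\to\mathbb Z$. A prime element of $A_L$ is a $\Pi_L\in A_L$ with $\mathfrak v_L(\Pi_L)=1$. For a finite Galois extension $L/F$ ($F/k$ finite separable) the reciprocity map is $$\Upsilon_{L/F}:\mathrm{Gal}(L/F)\to A_F/N_{L/F}A_L,\qquad \sigma\mapsto N_{\Sigma/F}\Pi_\Sigma \bmod N_{L/F}A_L,$$ where $\tilde\sigma\in\mathrm{Gal}(L_{\rm pur}/F)$ is any element with $\tilde\sigma|_L=\sigma$ and $\tilde\sigma|_{F_{\rm pur}}=\mathrm{Frob}_F^i$ for some integer $i>0$, $\Sigma$ is the fixed field of $\tilde\sigma$ in $L_{\rm pur}$, and $\Pi_\Sigma$ is any prime element of $A_\Sigma$.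 **(A3)** For every finite separable $F/k$ and every finite subextension $L/F$ of $F_{\rm pur}/F$ with $\mathrm{Gal}(L/F)$ generated by $\sigma$: (a) $|A_F:N_{L/F}A_L|=|L:F|$; (b) $0\to A_F\xrightarrow{i_{F/L}}A_L\xrightarrow{1-\sigma}A_L$ is exact; (c) $A_L\xrightarrow{1-\sigma}A_L\xrightarrow{N_{L/F}}A_F$ is exact. **(A4)** For every finite separable $F/k$, every cyclic extension $L/F$ of prime degree with generator $\sigma$ and every cyclic extension $L'/F$ of the same degree: (a) $A_L\xrightarrow{1-\sigma}A_L\xrightarrow{N_{L/F}}A_F$ is exact; (b) $|A_F:N_{L/F}A_L|=|L:F|$; (c) $N_{L'/F}A_{L'}=N_{L/F}A_L$ implies $L=L'$. **Theorem.** If (A1), (A2), (A3) hold, then for every finite Galois extension $L/F$ with $F/k$ finite separable the map $\Upsilon_{L/F}$ is well defined (an admissible $\tilde\sigma$ exists for every $\sigma$; for each admissible $\tilde\sigma$ the extension $\Sigma/F$ is finite and a prime element $\Pi_\Sigma$ exists; and the class of $N_{\Sigma/F}\Pi_\Sigma$ does not depend on the choices of $\tilde\sigma$ and $\Pi_\Sigma$),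 and it is a homomorphism. If moreover (A4) holds, then $\Upsilon_{L/F}$ induces an isomorphism $$\Upsilon_{L/F}^{\rm ab}:\mathrm{Gal}(L/F)^{\rm ab}\to A_F/N_{L/F}A_L .$$ -/

import Mathlib

open IntermediateField

universe u v w

/-- The profinite integers: compatible families of residue classes, with the topology
induced from the product of the finite discrete rings `ZMod n`. -/
def ZHat : Subring (∀ n : ℕ+, ZMod n) where
  carrier := {x | ∀ (m n : ℕ+) (h : (m : ℕ) ∣ n), ZMod.castHom h (ZMod m) (x n) = x m}
  mul_mem' := by
    intro a b ha hb m n h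
    simp only [Pi.mul_apply, map_mul, ha m n h, hb m n h]
  one_mem' := by
    intro m n h
    simp only [Pi.one_apply, map_one]
  add_mem' := by
    intro a b ha hb m n h
    simp only [Pi.add_apply, map_add, ha m n h, hb m n h]
  zero_mem' := by
    intro m n h
    simp only [Pi.zero_apply, map_zero]
  neg_mem' := by
    intro a ha m n h
    simp only [Pi.neg_apply, map_neg, ha m n h]

/-- The finite extensions of `k` inside `Ω`; when `Ω` is a separable closure of `k`, these are
the finite separable extensions of `k`. -/
abbrev FinExt (k : Type u) (Ω : Type v) [Field k] [Field Ω] [Algebra k Ω] : Type v :=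
  {F : IntermediateField k Ω // FiniteDimensional k F}

namespace FinExt

variable {k : Type u} {Ω : Type v} [Field k] [Field Ω] [Algebra k Ω]

/-- The ground field. -/
def ground (k : Type u) (Ω : Type v) [Field k] [Field Ω] [Algebra k Ω] : FinExt k Ω :=
  ⟨⊥, inferInstance⟩

theorem ground_le (F : FinExt k Ω) : ground k Ω ≤ F :=
  (bot_le : (⊥ : IntermediateField k Ω) ≤ F.1)

/-- The compositum `F L`. -/
def comp (F L : FinExt k Ω) : FinExt k Ω :=
  ⟨F.1 ⊔ L.1, by
    have := F.2
    have := L.2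
    infer_instance⟩

theorem left_le_comp (F L : FinExt k Ω) : F ≤ comp F L :=
  (le_sup_left : F.1 ≤ F.1 ⊔ L.1)

theorem right_le_comp (F L : FinExt k Ω) : L ≤ comp F L :=
  (le_sup_right : L.1 ≤ F.1 ⊔ L.1)

/-- The conjugate field `g F`. -/
def conj (g : Gal(Ω/k)) (F : FinExt k Ω) : FinExt k Ω :=
  ⟨F.1.map (g : Ω →ₐ[k] Ω), by
    have := F.2
    infer_instance⟩

theorem conj_mono (g : Gal(Ω/k)) {F L : FinExt k Ω} (h : F ≤ L) : conj g F ≤ conj g L :=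
  IntermediateField.map_mono (g : Ω →ₐ[k] Ω) h

/-- `L` as an extension of `F`, for `F ≤ L`. -/
abbrev relExt {F L : FinExt k Ω} (h : F ≤ L) : IntermediateField F.1 Ω :=
  extendScalars (F := F.1) (E := L.1) h

/-- The Galois group `Gal(L/F)`. -/
abbrev GalGroup {F L : FinExt k Ω} (h : F ≤ L) : Type v := relExt h ≃ₐ[F.1] relExt h

/-- The degree `|L : F|`. -/
noncomputable def degree {F L : FinExt k Ω} (h : F ≤ L) : ℕ := Module.finrank F.1 (relExt h)

/-- `τ` fixes `F` and restricts to `σ` on `L`. -/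
def Extends {F L : FinExt k Ω} (h : F ≤ L) (τ : Gal(Ω/k)) (σ : GalGroup h) : Prop :=
  ∀ x : relExt h, τ (x : Ω) = (σ x : Ω)

theorem Extends.conj_eq {F L : FinExt k Ω} {h : F ≤ L} {τ : Gal(Ω/k)} {σ : GalGroup h}
    (hτ : Extends h τ σ) : conj τ L = L := by
  apply Subtype.ext
  apply le_antisymm
  · rintro _ ⟨x, hx, rfl⟩
    have := hτ ⟨x, hx⟩
    change τ x ∈ L.1
    rw [this]
    exact (σ ⟨x, hx⟩).2
  · intro y hy
    refine ⟨(σ.symm ⟨y, hy⟩ : Ω), (σ.symm ⟨y, hy⟩).2, ?_⟩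
    have := hτ (σ.symm ⟨y, hy⟩)
    change τ _ = y
    rw [this, AlgEquiv.apply_symm_apply]

variable [IsSepClosure k Ω]

/-- A chosen extension of `σ ∈ Gal(L/F)` to an automorphism of `Ω`. -/
noncomputable def lift {F L : FinExt k Ω} (h : F ≤ L) (σ : GalGroup h) : Gal(Ω/k) :=
  (σ.liftNormal Ω).restrictScalars k

theorem extends_lift {F L : FinExt k Ω} (h : F ≤ L) (σ : GalGroup h) : Extends h (lift h σ) σ :=
  fun x => AlgEquiv.liftNormal_commutes σ Ω x

end FinExt

/-- A (cohomological) Mackey functor `F ↦ A_F` on the finite separable extensions of `k`: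
restriction maps `i_{F/L}`, norm maps `N_{L/F}` and conjugation maps `A_F → A_{gF}`, subject to
functoriality, equivariance, the Mackey double coset formula, and `N_{L/F} ∘ i_{F/L} = |L : F|`.
The target of `conj g` is passed as a field `F'` together with a proof of `F' = g F`. -/
structure MackeyFunctor (k : Type u) (Ω : Type v) [Field k] [Field Ω] [Algebra k Ω] where
  obj : FinExt k Ω → Type w
  [grp : ∀ F, AddCommGroup (obj F)]
  res : ∀ {F L : FinExt k Ω}, F ≤ L → obj F →+ obj L
  norm : ∀ {F L : FinExt k Ω}, F ≤ L → obj L →+ obj F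
  conj : ∀ (g : Gal(Ω/k)) {F F' : FinExt k Ω}, F' = F.conj g → obj F →+ obj F'
  res_self : ∀ (F : FinExt k Ω) (a : obj F), res (le_refl F) a = a
  res_res : ∀ {F L M : FinExt k Ω} (h : F ≤ L) (h' : L ≤ M) (a : obj F),
    res h' (res h a) = res (h.trans h') a
  norm_self : ∀ (F : FinExt k Ω) (a : obj F), norm (le_refl F) a = a
  norm_norm : ∀ {F L M : FinExt k Ω} (h : F ≤ L) (h' : L ≤ M) (a : obj M),
    norm h (norm h' a) = norm (h.trans h') a
  conj_of_mem : ∀ (g : Gal(Ω/k)) {F : FinExt k Ω} (h : F = F.conj g),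
    g ∈ F.1.fixingSubgroup → ∀ a : obj F, conj g h a = a
  conj_conj : ∀ (g g' : Gal(Ω/k)) {F F' F'' : FinExt k Ω} (h : F' = F.conj g)
    (h' : F'' = F'.conj g') (h'' : F'' = F.conj (g' * g)) (a : obj F),
    conj g' h' (conj g h a) = conj (g' * g) h'' a
  conj_res : ∀ (g : Gal(Ω/k)) {F L F' L' : FinExt k Ω} (h : F ≤ L) (h' : F' ≤ L')
    (hF : F' = F.conj g) (hL : L' = L.conj g) (a : obj F),
    conj g hL (res h a) = res h' (conj g hF a)
  conj_norm : ∀ (g : Gal(Ω/k)) {F L F' L' : FinExt k Ω} (h : F ≤ L) (h' : F' ≤ L')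
    (hF : F' = F.conj g) (hL : L' = L.conj g) (a : obj L),
    conj g hF (norm h a) = norm h' (conj g hL a)
  -- `T` is a system of representatives of the double cosets `G_M \ G_F / G_L`.
  double_coset : ∀ {F L M : FinExt k Ω} (hL : F ≤ L) (hM : F ≤ M) (T : Finset Gal(Ω/k)),
    (∀ t ∈ T, t ∈ F.1.fixingSubgroup) →
    (∀ g ∈ F.1.fixingSubgroup, ∃! t, t ∈ T ∧
      g ∈ DoubleCoset.doubleCoset t (M.1.fixingSubgroup : Set Gal(Ω/k))
        (L.1.fixingSubgroup : Set Gal(Ω/k))) →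
    ∀ a : obj L, res hM (norm hL a) =
      ∑ t ∈ T, norm (FinExt.left_le_comp M (L.conj t))
        (res (FinExt.right_le_comp M (L.conj t)) (conj t rfl a))
  norm_res : ∀ {F L : FinExt k Ω} (h : F ≤ L) (a : obj F),
    norm h (res h a) = FinExt.degree h • a

attribute [instance] MackeyFunctor.grp

namespace MackeyFunctor

variable {k : Type u} {Ω : Type v} [Field k] [Field Ω] [Algebra k Ω]

/-- The norm subgroup `N_{L/F} A_L` of `A_F`. -/
def normGroup (A : MackeyFunctor.{u, v, w} k Ω) {F L : FinExt k Ω} (h : F ≤ L) :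
    AddSubgroup (A.obj F) := (A.norm h).range

variable [IsSepClosure k Ω]

/-- The action of `σ ∈ Gal(L/F)` on `A_L`. -/
noncomputable def act (A : MackeyFunctor.{u, v, w} k Ω) {F L : FinExt k Ω} (h : F ≤ L)
    (σ : FinExt.GalGroup h) : A.obj L →+ A.obj L :=
  A.conj (FinExt.lift h σ) (FinExt.extends_lift h σ).conj_eq.symm

/-- The map `1 - σ` on `A_L`. -/
noncomputable def oneSub (A : MackeyFunctor.{u, v, w} k Ω) {F L : FinExt k Ω} (h : F ≤ L)
    (σ : FinExt.GalGroup h) : A.obj L →+ A.obj L :=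
  AddMonoidHom.id _ - A.act h σ

end MackeyFunctor

/-- (A1) A `Ẑ`-extension `k_pur` of the ground field inside `Ω`, together with an isomorphism of
topological groups `Gal(k_pur/k) ≃ Ẑ`. -/
structure ZHatExtension (k : Type u) (Ω : Type v) [Field k] [Field Ω] [Algebra k Ω] where
  pur : IntermediateField k Ω
  galois : IsGalois k pur
  iso : Gal(pur/k) ≃ₜ* Multiplicative ZHat

namespace ZHatExtension

variable {k : Type u} {Ω : Type v} [Field k] [Field Ω] [Algebra k Ω]

/-- The automorphism `Frob_k` of `k_pur` that corresponds to `1 ∈ Ẑ`. -/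
def frob (Z : ZHatExtension k Ω) : Gal(Z.pur/k) := Z.iso.symm (Multiplicative.ofAdd 1)

/-- `F_pur = F k_pur`. -/
def purOver (Z : ZHatExtension k Ω) (F : FinExt k Ω) : IntermediateField k Ω := F.1 ⊔ Z.pur

/-- `f_F = |F ∩ k_pur : k|`. -/
noncomputable def resDeg (Z : ZHatExtension k Ω) (F : FinExt k Ω) : ℕ :=
  Module.finrank k ↥(F.1 ⊓ Z.pur)

/-- `τ ∈ Gal(Ω/F)` restricts to `Frob_F ^ i` on `F_pur`. Here `Frob_F`, the generator of
`Gal(F_pur/F) ≃ Ẑ`, is the automorphism of `F_pur = F k_pur` that is trivial on `F` and equal to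
`Frob_k ^ f_F` on `k_pur`. -/
def RestrictsToFrobPow (Z : ZHatExtension k Ω) (F : FinExt k Ω) (τ : Gal(Ω/k)) (i : ℕ) : Prop :=
  τ ∈ F.1.fixingSubgroup ∧
    ∀ x : Z.pur, τ (x : Ω) = ((Z.frob ^ (i * Z.resDeg F)) x : Ω)

/-- The field of elements of `L_pur` fixed by `τ`. -/
def fixedIn (Z : ZHatExtension k Ω) (L : FinExt k Ω) (τ : Gal(Ω/k)) : IntermediateField k Ω :=
  Z.purOver L ⊓ fixedField (Subgroup.zpowers τ)

end ZHatExtension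

/-- (A2) A valuation homomorphism `v : A_k → ℤ` of the ground field, compatible with the
`Ẑ`-extension. -/
structure ClassValuation {k : Type u} {Ω : Type v} [Field k] [Field Ω] [Algebra k Ω]
    (A : MackeyFunctor.{u, v, w} k Ω) (Z : ZHatExtension k Ω) where
  val : A.obj (FinExt.ground k Ω) →+ ℤ
  surjective : Function.Surjective val
  map_norm : ∀ L : FinExt k Ω, (A.normGroup L.ground_le).map val =
    val.range.map (AddMonoidHom.mulLeft (Z.resDeg L : ℤ))

namespace ClassValuation

variable {k : Type u} {Ω : Type v} [Field k] [Field Ω] [Algebra k Ω]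
  {A : MackeyFunctor.{u, v, w} k Ω} {Z : ZHatExtension k Ω}

theorem dvd (V : ClassValuation A Z) (L : FinExt k Ω) (a : A.obj L) :
    (Z.resDeg L : ℤ) ∣ V.val (A.norm L.ground_le a) := by
  have h : V.val (A.norm L.ground_le a) ∈ (A.normGroup L.ground_le).map V.val :=
    ⟨_, ⟨a, rfl⟩, rfl⟩
  rw [V.map_norm L] at h
  obtain ⟨m, -, hm⟩ := h
  exact ⟨m, hm.symm⟩

/-- `v_L = (1 / |L ∩ k_pur : k|) v ∘ N_{L/k}` (the division is exact). -/
noncomputable def valOver (V : ClassValuation A Z) (L : FinExt k Ω) : A.obj L →+ ℤ where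
  toFun a := V.val (A.norm L.ground_le a) / (Z.resDeg L : ℤ)
  map_zero' := by simp
  map_add' a b := by
    rw [map_add, map_add, Int.add_ediv_of_dvd_left (V.dvd L a)]

/-- `ϖ` is a prime element of `A_L`. -/
def IsPrimeElement (V : ClassValuation A Z) (L : FinExt k Ω) (ϖ : A.obj L) : Prop :=
  V.valOver L ϖ = 1

/-- `Υ` is the reciprocity map `Gal(L/F) → A_F / N_{L/F} A_L`. Elements of `Gal(L_pur/F)` are
written as restrictions of automorphisms `τ` of `Ω`. Every `σ` has an admissible lift `τ`; for
every admissible lift the fixed field `S` of `τ` in `L_pur` is a finite extension of `F`, prime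
elements of `A_S` exist, and `Υ σ` is the class of `N_{S/F} ϖ` for every one of them. -/
def IsReciprocityMap (V : ClassValuation A Z) {F L : FinExt k Ω} (h : F ≤ L)
    (Υ : FinExt.GalGroup h → A.obj F ⧸ A.normGroup h) : Prop :=
  ∀ σ : FinExt.GalGroup h,
    (∃ (τ : Gal(Ω/k)) (i : ℕ), 0 < i ∧ FinExt.Extends h τ σ ∧ Z.RestrictsToFrobPow F τ i) ∧
    ∀ (τ : Gal(Ω/k)) (i : ℕ), 0 < i → FinExt.Extends h τ σ → Z.RestrictsToFrobPow F τ i →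
      ∃ (S : FinExt k Ω) (hS : F ≤ S), S.1 = Z.fixedIn L τ ∧
        (∃ ϖ, V.IsPrimeElement S ϖ) ∧
        ∀ ϖ, V.IsPrimeElement S ϖ → Υ σ = QuotientAddGroup.mk (A.norm hS ϖ)

end ClassValuation

section Axioms

variable {k : Type u} {Ω : Type v} [Field k] [Field Ω] [Algebra k Ω] [IsSepClosure k Ω]

/-- (A3), for all finite subextensions `L/F` of `F_pur/F`, `F` finite separable over `k`. -/
def AxiomA3 (A : MackeyFunctor.{u, v, w} k Ω) (Z : ZHatExtension k Ω) : Prop :=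
  ∀ (F L : FinExt k Ω) (h : F ≤ L), L.1 ≤ Z.purOver F →
    (A.normGroup h).index = FinExt.degree h ∧
    ∀ σ : FinExt.GalGroup h, Subgroup.zpowers σ = ⊤ →
      (Function.Injective (A.res h) ∧ Function.Exact (A.res h) (A.oneSub h σ)) ∧
      Function.Exact (A.oneSub h σ) (A.norm h)

/-- (A4), for all cyclic extensions `L/F` and `L'/F` of the same prime degree,
`F` finite separable over `k`. -/
def AxiomA4 (A : MackeyFunctor.{u, v, w} k Ω) : Prop :=
  ∀ (F L : FinExt k Ω) (h : F ≤ L), IsGalois F.1 (FinExt.relExt h) → (FinExt.degree h).Prime →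
    (∀ σ : FinExt.GalGroup h, Subgroup.zpowers σ = ⊤ →
      Function.Exact (A.oneSub h σ) (A.norm h)) ∧
    (A.normGroup h).index = FinExt.degree h ∧
    ∀ (L' : FinExt k Ω) (h' : F ≤ L'), IsGalois F.1 (FinExt.relExt h') →
      FinExt.degree h' = FinExt.degree h → A.normGroup h' = A.normGroup h → L = L'

end Axioms

/-! ### Finite extensions and open subgroups -/

/-! This is abstract class field theory in the style of Neukirch, done with open subgroups of the
absolute Galois group G_k and the map `deg` from G_k to `ZHat`, whose kernel is `inertia`. The image
of G_F is f_F·Ẑ. A Frobenius lift over F is some τ in G_F with deg τ = n f_F and n > 0. Its fixed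
field Σ in L_pur is finite over F, has residue degree n f_F, and satisfies Σk_N = Lk_N for suitable
N (`gal_fixedIn_inf_level`), where k_N is the degree N layer of k_pur.

In unramified extensions (A3) makes every element of valuation 0 a norm (`exists_norm_eq`). Applied
to LΣ/Σ, this shows that the choice of prime element is immaterial. The main point is
multiplicativity. Let W = Fk_N, M = Lk_N, and let φ lift Frob_F. The double coset formula writes the
restriction of N_{Σ/F}Π to W as N_{M/W}X with X = Σ_{j<n} φ^j Π, and telescoping gives (φ-1)X = (φ^n
τ⁻¹ - 1)Π with φ^n τ⁻¹ inertial. Comparing two lifts with their product yields x of valuation 0 such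
that (φ-1)x is a sum of terms (t-1)u with t inertial and u of valuation 0.
`mem_normGroup_of_relation` turns this into a norm from L. Independence of the lift is then formal,
because a lift that fixes L has L ⊆ Σ and hence trivial class (`frobNorm_congr`).

Under (A4), in prime degree source and target have the same order, so a nontrivial map is an
isomorphism. If L lies in F_pur, the valuation detects nontriviality. Otherwise a trivial map would
give L and a twisted field Σ ≠ L the same norm group, against (A4)(c). Surjectivity passes up towers
for p-groups, and then to all groups by Sylow and N∘i = degree. For abelian L/F, injectivity is an
induction through a subextension of prime degree, using Hilbert 90 from (A4)(a). In general one
passes to the fixed field of the commutator subgroup. -/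

namespace FinExt

variable {k : Type u} {Ω : Type v} [Field k] [Field Ω] [Algebra k Ω]

/-- The absolute Galois group of `F`, as a subgroup of `Gal(Ω/k)`. -/
abbrev gal (F : FinExt k Ω) : Subgroup Gal(Ω/k) := F.1.fixingSubgroup

/-- `L` is stable under the automorphisms that fix `F`. -/
def NormalOver (F L : FinExt k Ω) : Prop := ∀ g ∈ F.gal, L = L.conj g

theorem gal_le {F L : FinExt k Ω} (h : F ≤ L) : L.gal ≤ F.gal :=
  fixingSubgroup_le h

theorem gal_isOpen (F : FinExt k Ω) : IsOpen (F.gal : Set Gal(Ω/k)) :=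
  have := F.2
  F.1.fixingSubgroup_isOpen

theorem gal_comp (F L : FinExt k Ω) : (comp F L).gal = F.gal ⊓ L.gal :=
  fixingSubgroup_sup

theorem mem_gal_conj {F : FinExt k Ω} {g h : Gal(Ω/k)} :
    h ∈ (F.conj g).gal ↔ g⁻¹ * h * g ∈ F.gal := by
  simp only [gal, conj, IsGalois.map_fixingSubgroup, Subgroup.mem_pointwise_smul_iff_inv_smul_mem]
  simp [MulAut.smul_def, ← map_inv, mul_assoc]

theorem gal_ground : (ground k Ω).gal = ⊤ := fixingSubgroup_bot

theorem conj_one (F : FinExt k Ω) : F.conj 1 = F :=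
  Subtype.ext (IntermediateField.map_id F.1)

theorem conj_mul (F : FinExt k Ω) (g h : Gal(Ω/k)) : F.conj (g * h) = (F.conj h).conj g :=
  Subtype.ext (IntermediateField.map_map F.1 (h : Ω →ₐ[k] Ω) (g : Ω →ₐ[k] Ω)).symm

theorem conj_ground (g : Gal(Ω/k)) : (ground k Ω).conj g = ground k Ω :=
  Subtype.ext (IntermediateField.map_bot _)

theorem conj_of_mem {F : FinExt k Ω} {g : Gal(Ω/k)} (hg : g ∈ F.gal) : F = F.conj g := by
  apply Subtype.ext
  rw [IntermediateField.mem_fixingSubgroup_iff] at hg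
  ext x
  constructor
  · intro hx
    exact ⟨x, hx, hg x hx⟩
  · rintro ⟨y, hy, rfl⟩
    have : (g : Ω →ₐ[k] Ω) y = y := hg y hy
    change (g : Ω →ₐ[k] Ω) y ∈ F.1
    rwa [this]

theorem NormalOver.of_le {F M L : FinExt k Ω} (h : F.NormalOver L) (hM : F ≤ M) :
    M.NormalOver L := fun g hg => h g (gal_le hM hg)

theorem NormalOver.comp {F L M : FinExt k Ω} (hL : F.NormalOver L) (hM : F.NormalOver M) :
    F.NormalOver (comp L M) := by
  intro g hg
  apply Subtype.ext
  have h1 := congrArg Subtype.val (hL g hg)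
  have h2 := congrArg Subtype.val (hM g hg)
  simp only [FinExt.comp, conj] at h1 h2 ⊢
  rw [IntermediateField.map_sup, ← h1, ← h2]

theorem normalOver_self (F : FinExt k Ω) : F.NormalOver F := fun _ hg => conj_of_mem hg

theorem NormalOver.conj_mem {F L : FinExt k Ω} (hL : F.NormalOver L) {g h : Gal(Ω/k)}
    (hg : g ∈ F.gal) (hh : h ∈ L.gal) : g * h * g⁻¹ ∈ L.gal := by
  rw [hL g hg, mem_gal_conj]
  simpa [mul_assoc] using hh

theorem ext_iff_gal {L : FinExt k Ω} {g h : Gal(Ω/k)} :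
    (∀ x ∈ L.1, g x = h x) ↔ h⁻¹ * g ∈ L.gal := by
  rw [IntermediateField.mem_fixingSubgroup_iff]
  refine forall₂_congr fun x _ => ?_
  rw [AlgEquiv.mul_apply]
  exact ⟨fun e => by rw [e]; exact AlgEquiv.symm_apply_apply h x,
    fun e => by conv_rhs => rw [← e]
                exact (AlgEquiv.apply_symm_apply h (g x)).symm⟩

theorem normalOver_of_isGalois {F L : FinExt k Ω} [Normal k Ω] (h : F ≤ L)
    (hG : IsGalois F.1 (relExt h)) : F.NormalOver L := by
  intro g hg
  have hN : Normal F.1 (relExt h) := hG.to_normal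
  have : Normal F.1 Ω := Normal.tower_top_of_normal k F.1 Ω
  have := normal_iff_forall_map_eq'.1 hN (IntermediateField.fixingSubgroupEquiv F.1 ⟨g, hg⟩)
  apply Subtype.ext
  ext x
  have h2 := SetLike.ext_iff.1 this x
  exact h2.symm

variable [IsGalois k Ω]

theorem le_of_gal_le {F L : FinExt k Ω} (h : L.gal ≤ F.gal) : F ≤ L := by
  have := (fixedField_le h)
  rwa [InfiniteGalois.fixedField_fixingSubgroup, InfiniteGalois.fixedField_fixingSubgroup] at this

theorem eq_of_gal_eq {F L : FinExt k Ω} (h : L.gal = F.gal) : F = L :=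
  le_antisymm (le_of_gal_le h.le) (le_of_gal_le h.ge)

theorem fixingSubgroup_fixedField_of_isOpen {H : Subgroup Gal(Ω/k)}
    (hH : IsOpen (H : Set Gal(Ω/k))) : (fixedField H).fixingSubgroup = H :=
  InfiniteGalois.fixingSubgroup_fixedField ⟨H, Subgroup.isClosed_of_isOpen H hH⟩

/-- The field fixed by an open subgroup. -/
noncomputable def ofOpen (H : Subgroup Gal(Ω/k)) (hH : IsOpen (H : Set Gal(Ω/k))) : FinExt k Ω :=
  ⟨fixedField H, by
    rw [← InfiniteGalois.isOpen_iff_finite]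
    have := fixingSubgroup_fixedField_of_isOpen hH
    rw [this]
    exact hH⟩

theorem gal_ofOpen (H : Subgroup Gal(Ω/k)) (hH : IsOpen (H : Set Gal(Ω/k))) :
    (ofOpen H hH).gal = H := fixingSubgroup_fixedField_of_isOpen hH

theorem normalOver_iff {F L : FinExt k Ω} :
    F.NormalOver L ↔ ∀ g ∈ F.gal, ∀ h ∈ L.gal, g * h * g⁻¹ ∈ L.gal := by
  refine ⟨fun hL g hg h hh => hL.conj_mem hg hh, fun H g hg => eq_of_gal_eq ?_⟩
  ext x
  rw [mem_gal_conj]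
  constructor
  · intro hx
    simpa [mul_assoc] using H g hg _ hx
  · intro hx
    simpa using H g⁻¹ (inv_mem hg) _ hx

theorem isGalois_of_normalOver {F L : FinExt k Ω} (h : F ≤ L) (hL : F.NormalOver L) :
    IsGalois F.1 (relExt h) := by
  have : IsGalois F.1 Ω := IsGalois.tower_top_of_isGalois k F.1 Ω
  have hN : Normal F.1 (relExt h) := by
    rw [normal_iff_forall_map_le']
    rintro σ _ ⟨x, hx, rfl⟩
    have h2 := hL _ ((IntermediateField.fixingSubgroupEquiv F.1).symm σ).2
    have h3 : σ x ∈ (L.conj ((IntermediateField.fixingSubgroupEquiv F.1).symm σ)).1 :=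
      ⟨x, hx, rfl⟩
    rw [← h2] at h3
    exact h3
  exact ⟨⟩

/-- From here on degrees are indices of open subgroups, and the tower law is multiplicativity of the
index. -/
theorem degree_eq_relIndex {F L : FinExt k Ω} (h : F ≤ L) : degree h = L.gal.relIndex F.gal := by
  have : IsGalois F.1 Ω := IsGalois.tower_top_of_isGalois k F.1 Ω
  rw [degree, finrank_eq_fixingSubgroup_index, Subgroup.relIndex,
    ← Subgroup.index_map_equiv _ (IntermediateField.fixingSubgroupEquiv F.1)]
  congr 1
  ext σ
  constructor
  · intro hσ
    refine ⟨(IntermediateField.fixingSubgroupEquiv F.1).symm σ, ?_, by simp⟩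
    change (_ : Gal(Ω/k)) ∈ L.gal
    rw [IntermediateField.mem_fixingSubgroup_iff] at hσ ⊢
    exact hσ
  · rintro ⟨τ, hτ, rfl⟩
    have hτ : (τ : Gal(Ω/k)) ∈ L.gal := hτ
    rw [IntermediateField.mem_fixingSubgroup_iff] at hτ ⊢
    exact hτ

theorem index_gal_ne_zero (F : FinExt k Ω) : F.gal.index ≠ 0 := by
  have := F.2
  rw [← finrank_eq_fixingSubgroup_index]
  exact Module.finrank_pos.ne'

theorem degree_pos {F L : FinExt k Ω} (h : F ≤ L) : 0 < degree h := by
  rw [degree_eq_relIndex]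
  refine Nat.pos_of_ne_zero fun h0 => L.index_gal_ne_zero ?_
  exact Subgroup.index_eq_zero_of_relIndex_eq_zero h0

theorem degree_mul_degree {F L M : FinExt k Ω} (h : F ≤ L) (h' : L ≤ M) :
    degree h * degree h' = degree (h.trans h') := by
  rw [degree_eq_relIndex, degree_eq_relIndex, degree_eq_relIndex, mul_comm]
  exact Subgroup.relIndex_mul_relIndex _ _ _ (gal_le h') (gal_le h)

theorem eq_of_degree_eq_one {F L : FinExt k Ω} (h : F ≤ L) (h1 : degree h = 1) : F = L := by
  rw [degree_eq_relIndex, Subgroup.relIndex_eq_one] at h1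
  exact le_antisymm h (le_of_gal_le h1)

theorem pow_degree_mem {F L : FinExt k Ω} (h : F ≤ L) (hL : F.NormalOver L) {g : Gal(Ω/k)}
    (hg : g ∈ F.gal) {e : ℕ} (he : degree h ∣ e) : g ^ e ∈ L.gal := by
  have : (L.gal.subgroupOf F.gal).Normal :=
    ⟨fun n hn g => hL.conj_mem g.2 hn⟩
  obtain ⟨c, rfl⟩ := he
  have := Subgroup.pow_index_mem (L.gal.subgroupOf F.gal) ⟨g, hg⟩
  rw [pow_mul]
  rw [degree_eq_relIndex]
  exact pow_mem this c

end FinExt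

/-! ### The degree map -/

/-- The finite-level substitute for the density of ℤ in Ẑ: one integer serves all divisors of N at
once. -/
theorem ZHat.exists_int (x : ZHat) (N : ℕ+) :
    ∃ a : ℤ, ∀ m : ℕ+, (m : ℕ) ∣ N → x.1 m = a := by
  obtain ⟨a, ha⟩ := ZMod.intCast_surjective (x.1 N)
  refine ⟨a, fun m hm => ?_⟩
  rw [← x.2 m N hm, ← ha]
  simp

theorem ZHat.eq_zero_of_dvd {x : ZHat} {m N : ℕ+} (h : (m : ℕ) ∣ N) (hx : x.1 N = 0) :
    x.1 m = 0 := by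
  rw [← x.2 m N h, hx, map_zero]

namespace ZHatExtension

variable {k : Type u} {Ω : Type v} [Field k] [Field Ω] [Algebra k Ω]
  (Z : ZHatExtension k Ω)

/-- The absolute Galois group of `k_pur`. -/
abbrev inertia : Subgroup Gal(Ω/k) := Z.pur.fixingSubgroup

/-- The homomorphism `Gal(Ω/k) → Gal(k_pur/k) ≃ Ẑ`. -/
noncomputable def degHom : Gal(Ω/k) →* Multiplicative ZHat :=
  have := Z.galois
  (Z.iso.toMulEquiv.toMonoidHom).comp (AlgEquiv.restrictNormalHom Z.pur)

/-- The image of `g` under `Gal(Ω/k) → Gal(k_pur/k) ≃ Ẑ`. -/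
noncomputable def deg (g : Gal(Ω/k)) : ZHat := (Z.degHom g).toAdd

theorem deg_mul (g h : Gal(Ω/k)) : Z.deg (g * h) = Z.deg g + Z.deg h := by simp [deg]

theorem deg_one : Z.deg 1 = 0 := by simp [deg]

theorem deg_inv (g : Gal(Ω/k)) : Z.deg g⁻¹ = - Z.deg g := by simp [deg]

theorem deg_pow (g : Gal(Ω/k)) (n : ℕ) : Z.deg (g ^ n) = n • Z.deg g := by simp [deg]

theorem deg_zpow (g : Gal(Ω/k)) (n : ℤ) : Z.deg (g ^ n) = n • Z.deg g := by simp [deg]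

theorem deg_conj (g h : Gal(Ω/k)) : Z.deg (g * h * g⁻¹) = Z.deg h := by
  simp [deg_mul, deg_inv]

theorem deg_eq_zero_iff {g : Gal(Ω/k)} : Z.deg g = 0 ↔ g ∈ Z.inertia := by
  have := Z.galois
  have h1 : Z.deg g = 0 ↔ AlgEquiv.restrictNormalHom Z.pur g = 1 := by
    simp only [deg, degHom]
    change Z.iso (AlgEquiv.restrictNormalHom Z.pur g) = 1 ↔ _
    exact map_eq_one_iff _ Z.iso.injective
  rw [h1, IntermediateField.mem_fixingSubgroup_iff]
  constructor
  · intro h x hx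
    have := AlgEquiv.restrictNormal_commutes g Z.pur ⟨x, hx⟩
    have h2 : g.restrictNormal Z.pur = 1 := h
    rw [h2] at this
    exact this.symm
  · intro h
    ext x
    have := AlgEquiv.restrictNormal_commutes g Z.pur x
    exact this.trans (h x x.2)

theorem deg_eq_nat_iff {g : Gal(Ω/k)} {n : ℕ} :
    Z.deg g = n ↔ ∀ x : Z.pur, g (x : Ω) = ((Z.frob ^ n) x : Ω) := by
  have := Z.galois
  have h1 : Z.deg g = n ↔ AlgEquiv.restrictNormalHom Z.pur g = Z.frob ^ n := by
    rw [← Z.iso.injective.eq_iff, map_pow, frob]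
    have : Z.iso (Z.iso.symm (Multiplicative.ofAdd 1)) = Multiplicative.ofAdd 1 :=
      Z.iso.apply_symm_apply _
    rw [this, ← ofAdd_nsmul, nsmul_one]
    exact Iff.rfl
  rw [h1]
  constructor
  · intro h x
    have := AlgEquiv.restrictNormal_commutes g Z.pur x
    have h2 : g.restrictNormal Z.pur = Z.frob ^ n := h
    rw [h2] at this
    exact this.symm
  · intro h
    ext x
    have := AlgEquiv.restrictNormal_commutes g Z.pur x
    exact this.trans (h x)

theorem exists_deg_eq_one [IsGalois k Ω] : ∃ g, Z.deg g = 1 := by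
  have := Z.galois
  obtain ⟨g, hg⟩ := AlgEquiv.restrictNormalHom_surjective Ω (Z.iso.symm (Multiplicative.ofAdd 1))
  refine ⟨g, ?_⟩
  simp only [deg, degHom]
  change Z.iso (AlgEquiv.restrictNormalHom Z.pur g) = Multiplicative.ofAdd 1
  rw [hg]
  exact Z.iso.apply_symm_apply _

/-- The automorphisms that are trivial on the degree `N` subextension of `k_pur`. -/
noncomputable def level (N : ℕ+) : Subgroup Gal(Ω/k) where
  carrier := {g | (Z.deg g).1 N = 0}
  mul_mem' := by
    intro a b ha hb
    simp only [Set.mem_ofPred_eq] at ha hb ⊢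
    simp [deg_mul, ha, hb]
  one_mem' := by simp [deg_one]
  inv_mem' := by
    intro a ha
    simp only [Set.mem_ofPred_eq] at ha ⊢
    simp [deg_inv, ha]

variable {Z}

theorem mem_level {N : ℕ+} {g : Gal(Ω/k)} : g ∈ Z.level N ↔ (Z.deg g).1 N = 0 := Iff.rfl

theorem mem_level_of_natCast {N : ℕ+} {g : Gal(Ω/k)} {n : ℕ} (h : Z.deg g = n)
    (hn : (N : ℕ) ∣ n) : g ∈ Z.level N := by
  rw [mem_level, h]
  simpa using (ZMod.natCast_eq_zero_iff n N).2 hn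

theorem level_le {m N : ℕ+} (h : (m : ℕ) ∣ N) : Z.level N ≤ Z.level m :=
  fun _ hg => ZHat.eq_zero_of_dvd h hg

theorem inertia_le_level (N : ℕ+) : Z.inertia ≤ Z.level N := by
  intro g hg
  rw [← deg_eq_zero_iff] at hg
  simp [mem_level, hg]

theorem level_normal_of {N : ℕ+} : (Z.level N).Normal :=
  ⟨fun n hn g => by rwa [mem_level, deg_conj]⟩

theorem mem_inertia_of_forall {g : Gal(Ω/k)} (h : ∀ N, g ∈ Z.level N) : g ∈ Z.inertia := by
  rw [← deg_eq_zero_iff]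
  exact Subtype.ext (funext h)

theorem level_isOpen (N : ℕ+) : IsOpen (Z.level N : Set Gal(Ω/k)) := by
  have := Z.galois
  have hc : Continuous fun g : Gal(Ω/k) => (Z.deg g).1 N := by
    have h1 : Continuous fun g : Gal(Ω/k) => Z.iso (AlgEquiv.restrictNormalHom Z.pur g) :=
      Z.iso.continuous_toFun.comp (InfiniteGalois.restrictNormalHom_continuous Z.pur)
    exact (continuous_apply N).comp (continuous_subtype_val.comp h1)
  exact (isOpen_discrete {(0 : ZMod N)}).preimage hc

variable [IsGalois k Ω]

theorem index_level (N : ℕ+) : (Z.level N).index = N := by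
  let f : Gal(Ω/k) →* Multiplicative (ZMod N) :=
    { toFun := fun g => Multiplicative.ofAdd ((Z.deg g).1 N)
      map_one' := by simp [deg_one]
      map_mul' := fun a b => by simp [deg_mul] }
  have hf : f.ker = Z.level N := by
    ext g
    exact Iff.rfl
  have hs : Function.Surjective f := by
    intro x
    obtain ⟨n, hn⟩ := ZMod.natCast_zmod_surjective x.toAdd
    obtain ⟨g, hg⟩ := Z.exists_deg_eq_one
    refine ⟨g ^ n, ?_⟩
    apply Multiplicative.toAdd.injective
    simp only [f, MonoidHom.coe_mk, OneHom.coe_mk, deg_pow, hg, toAdd_ofAdd, ← hn]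
    simp
  rw [← hf, Subgroup.index_ker, MonoidHom.range_eq_top.2 hs, Subgroup.card_top]
  simp

/-- A closed subgroup whose intersection with the inertia group lies in an open subgroup `U`
satisfies this already at a finite level. -/
theorem exists_level_le {C U : Subgroup Gal(Ω/k)} (hC : IsClosed (C : Set Gal(Ω/k)))
    (hU : IsOpen (U : Set Gal(Ω/k))) (h : C ⊓ Z.inertia ≤ U) :
    ∃ N : ℕ+, C ⊓ Z.level N ≤ U := by
  have hK : IsCompact ((C : Set Gal(Ω/k)) ∩ (U : Set Gal(Ω/k))ᶜ) :=
    (hC.inter hU.isClosed_compl).isCompact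
  -- The part of C outside U is compact, and the levels form a directed family of closed sets whose
  -- intersection is the inertia group.
  obtain ⟨N, hN⟩ := hK.elim_directed_family_closed
    (fun N : ℕ+ => (Z.level N : Set Gal(Ω/k)))
    (fun N => Subgroup.isClosed_of_isOpen _ (level_isOpen N)) (by
      ext g
      simp only [Set.mem_inter_iff, Set.mem_iInter, Set.mem_empty_iff_false, iff_false]
      rintro ⟨⟨h1, h2⟩, h3⟩
      exact h2 (h ⟨h1, mem_inertia_of_forall h3⟩)) (by
      intro a b
      refine ⟨a * b, ?_, ?_⟩
      · exact level_le (by simp)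
      · exact level_le (by simp))
  refine ⟨N, fun g hg => ?_⟩
  by_contra hgU
  have : g ∈ (∅ : Set Gal(Ω/k)) := hN ▸ ⟨⟨hg.1, hgU⟩, hg.2⟩
  exact this

end ZHatExtension

/-! ### Residue degrees and the layers of the unramified tower -/

namespace ZHatExtension

open FinExt

variable {k : Type u} {Ω : Type v} [Field k] [Field Ω] [Algebra k Ω]
  {Z : ZHatExtension k Ω}

theorem natCast_val_apply (n : ℕ) (N : ℕ+) : ((n : ZHat).1 N) = (n : ZMod N) := rfl

theorem exists_zpow_mul_mem_level {τ g : Gal(Ω/k)} {ν : ℕ+} (hτ : Z.deg τ = (ν : ℕ))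
    (hg : g ∈ Z.level ν) {N : ℕ+} (hN : (ν : ℕ) ∣ N) :
    ∃ c : ℤ, g * (τ ^ c)⁻¹ ∈ Z.level N := by
  obtain ⟨a, ha⟩ := ZHat.exists_int (Z.deg g) N
  rw [mem_level, ha ν hN, ZMod.intCast_zmod_eq_zero_iff_dvd] at hg
  obtain ⟨c, rfl⟩ := hg
  refine ⟨c, ?_⟩
  rw [mem_level, deg_mul, deg_inv, deg_zpow, hτ]
  have : (Z.deg g).1 N + -(c • (((ν : ℕ) : ZHat)).1 N) = 0 := by
    rw [ha N dvd_rfl, natCast_val_apply]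
    push_cast
    rw [zsmul_eq_mul]
    ring
  exact this

theorem zpow_mem_level_iff {τ : Gal(Ω/k)} {ν : ℕ} (hτ : Z.deg τ = ν) {c : ℤ} {N : ℕ+} :
    τ ^ c ∈ Z.level N ↔ (N : ℤ) ∣ c * ν := by
  rw [mem_level, deg_zpow, hτ, ← ZMod.intCast_zmod_eq_zero_iff_dvd]
  have : (c • ((ν : ℕ) : ZHat)).1 N = ((c * ν : ℤ) : ZMod N) := by
    have h : (c • ((ν : ℕ) : ZHat)).1 N = c • (((ν : ℕ) : ZHat)).1 N := rfl
    rw [h, natCast_val_apply]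
    push_cast
    rw [zsmul_eq_mul]
  rw [this]

variable (Z) in
theorem gal_sup_inertia_isOpen (F : FinExt k Ω) :
    IsOpen ((F.gal ⊔ Z.inertia : Subgroup Gal(Ω/k)) : Set Gal(Ω/k)) :=
  Subgroup.isOpen_mono le_sup_left F.gal_isOpen

theorem zpowers_sup_isOpen (L : FinExt k Ω) (τ : Gal(Ω/k)) (N : ℕ+) : IsOpen
    ((Subgroup.zpowers τ ⊔ (L.gal ⊓ Z.level N) : Subgroup Gal(Ω/k)) : Set Gal(Ω/k)) :=
  Subgroup.isOpen_mono le_sup_right (L.gal_isOpen.inter (level_isOpen N))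

variable [IsGalois k Ω]

/-- By compactness B contains some level. Modulo it, an element of level f is a power of φ^f with
deg φ = 1, and φ^f lies in B because B has index f and is normal, commutators being inertial.
Equality of indices finishes. -/
theorem eq_level_index {B : Subgroup Gal(Ω/k)} (hB : IsOpen (B : Set Gal(Ω/k)))
    (hi : Z.inertia ≤ B) {f : ℕ+} (hf : B.index = f) : B = Z.level f := by
  have hn : B.Normal := ⟨fun n hn g => by
    have : g * n * g⁻¹ * n⁻¹ ∈ Z.inertia := by
      rw [← deg_eq_zero_iff]
      simp [deg_mul, deg_inv]
    simpa using B.mul_mem (hi this) hn⟩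
  obtain ⟨N, hN⟩ := exists_level_le (Z := Z) (C := ⊤) (by simp [isClosed_univ]) hB (by simpa using hi)
  rw [top_inf_eq] at hN
  have hle : Z.level f ≤ B := by
    intro g hg
    obtain ⟨φ, hφ⟩ := Z.exists_deg_eq_one
    obtain ⟨c, hc⟩ := exists_zpow_mul_mem_level (τ := φ ^ (f : ℕ)) (by simp [deg_pow, hφ]) hg
      (N := f * N) (by simp)
    have h1 := hN (level_le (by simp) hc)
    have h2 : (φ ^ (f : ℕ)) ^ c ∈ B := zpow_mem (hf ▸ Subgroup.pow_index_mem B φ) c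
    simpa using B.mul_mem h1 h2
  refine le_antisymm ?_ hle
  have := Subgroup.relIndex_mul_index hle
  rw [index_level, hf] at this
  rw [← Subgroup.relIndex_eq_one]
  exact Nat.eq_of_mul_eq_mul_right f.pos (this.trans (one_mul _).symm)

variable (Z) in
theorem resDeg_eq_index (F : FinExt k Ω) : Z.resDeg F = (F.gal ⊔ Z.inertia).index := by
  rw [← fixingSubgroup_fixedField_of_isOpen (Z.gal_sup_inertia_isOpen F),
    ← finrank_eq_fixingSubgroup_index]
  have : F.1 ⊓ Z.pur = fixedField (F.gal ⊔ Z.inertia) := by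
    refine eq_of_forall_le_iff fun K => ?_
    rw [IntermediateField.le_iff_le, sup_le_iff, ← IntermediateField.le_iff_le,
      ← IntermediateField.le_iff_le, InfiniteGalois.fixedField_fixingSubgroup,
      InfiniteGalois.fixedField_fixingSubgroup, le_inf_iff]
  rw [resDeg, this]

variable (Z) in
theorem resDeg_pos (F : FinExt k Ω) : 0 < Z.resDeg F := by
  rw [resDeg_eq_index]
  refine Nat.pos_of_ne_zero fun h => F.index_gal_ne_zero ?_
  exact Nat.eq_zero_of_zero_dvd (h ▸ Subgroup.index_dvd_of_le le_sup_left)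

variable (Z) in
/-- The residue degree `f_F` as a positive integer. -/
noncomputable def resDegP (F : FinExt k Ω) : ℕ+ := ⟨Z.resDeg F, Z.resDeg_pos F⟩

@[simp]
theorem coe_resDegP (F : FinExt k Ω) : (Z.resDegP F : ℕ) = Z.resDeg F := rfl

variable (Z) in
-- This says that `deg` maps G_F onto f_F·Ẑ.
theorem gal_sup_inertia (F : FinExt k Ω) : F.gal ⊔ Z.inertia = Z.level (Z.resDegP F) :=
  eq_level_index (Z.gal_sup_inertia_isOpen F) le_sup_right (Z.resDeg_eq_index F).symm

theorem resDeg_eq_of_sup {F : FinExt k Ω} {N : ℕ+} (h : F.gal ⊔ Z.inertia = Z.level N) :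
    Z.resDeg F = N := by
  rw [resDeg_eq_index, h, index_level]

theorem gal_le_level (F : FinExt k Ω) : F.gal ≤ Z.level (Z.resDegP F) :=
  Z.gal_sup_inertia F ▸ le_sup_left

instance inertia_normal : Z.inertia.Normal :=
  ⟨fun n hn g => by rwa [← deg_eq_zero_iff, deg_conj, deg_eq_zero_iff]⟩

theorem exists_mem_gal_deg_eq {F : FinExt k Ω} {g : Gal(Ω/k)}
    (hg : g ∈ Z.level (Z.resDegP F)) : ∃ l ∈ F.gal, Z.deg l = Z.deg g := by
  rw [← gal_sup_inertia, Subgroup.mem_sup_of_normal_right] at hg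
  obtain ⟨l, hl, s, hs, rfl⟩ := hg
  refine ⟨l, hl, ?_⟩
  rw [deg_mul, (Z.deg_eq_zero_iff).2 hs, add_zero]

variable (Z) in
/-- An extension of `Frob_F` exists. -/
theorem exists_mem_gal_deg_eq_resDeg (F : FinExt k Ω) : ∃ φ ∈ F.gal, Z.deg φ = Z.resDeg F := by
  obtain ⟨φ, hφ⟩ := Z.exists_deg_eq_one
  have h1 : Z.deg (φ ^ Z.resDeg F) = Z.resDeg F := by simp [deg_pow, hφ]
  obtain ⟨l, hl, h⟩ := exists_mem_gal_deg_eq (F := F) (g := φ ^ Z.resDeg F)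
    (mem_level_of_natCast h1 dvd_rfl)
  exact ⟨l, hl, h.trans h1⟩

theorem resDeg_dvd {F L : FinExt k Ω} (h : F ≤ L) : Z.resDeg F ∣ Z.resDeg L := by
  rw [resDeg_eq_index, resDeg_eq_index]
  exact Subgroup.index_dvd_of_le (sup_le_sup_right (gal_le h) _)

theorem le_purOver_iff {F L : FinExt k Ω} : L.1 ≤ Z.purOver F ↔ F.gal ⊓ Z.inertia ≤ L.gal := by
  rw [purOver, ← InfiniteGalois.fixedField_fixingSubgroup (F.1 ⊔ Z.pur),
    IntermediateField.fixingSubgroup_sup]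
  constructor
  · intro h
    exact (IntermediateField.le_iff_le _ _).1 h
  · intro h
    exact (IntermediateField.le_iff_le _ _).2 h

/-- For `L` inside `F_pur`, the degree `|L : F|` is `f_L / f_F`. -/
theorem degree_mul_resDeg {F L : FinExt k Ω} (h : F ≤ L) (hL : F.gal ⊓ Z.inertia ≤ L.gal) :
    degree h * Z.resDeg F = Z.resDeg L := by
  have : (L.gal ⊔ Z.inertia).Normal := by rw [gal_sup_inertia]; exact level_normal_of
  have h1 : L.gal ⊔ Z.inertia ≤ F.gal ⊔ Z.inertia := sup_le_sup_right (gal_le h) _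
  rw [resDeg_eq_index, resDeg_eq_index, ← Subgroup.relIndex_mul_index h1, degree_eq_relIndex]
  congr 1
  have h2 : F.gal ⊔ Z.inertia = F.gal ⊔ (L.gal ⊔ Z.inertia) := by
    rw [← sup_assoc, sup_eq_left.2 (gal_le h)]
  -- Second isomorphism theorem; by `hL` the part of G_L·I inside G_F is G_L itself, where I is the
  -- inertia group.
  rw [h2, Subgroup.relIndex_sup_right, ← Subgroup.inf_relIndex_right (L.gal ⊔ Z.inertia)]
  congr 1
  refine le_antisymm (le_inf le_sup_left (gal_le h)) ?_
  rintro g ⟨hg, hgF⟩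
  have hg : g ∈ L.gal ⊔ Z.inertia := hg
  rw [Subgroup.mem_sup_of_normal_right] at hg
  obtain ⟨l, hl, s, hs, rfl⟩ := hg
  refine mul_mem hl (hL ⟨?_, hs⟩)
  have := F.gal.mul_mem (F.gal.inv_mem (gal_le h hl)) hgF
  simpa using this

variable (Z) in
/-- The subextension of `k_pur` of degree `N`. -/
noncomputable def levelField (N : ℕ+) : FinExt k Ω := ofOpen (Z.level N) (level_isOpen N)

theorem gal_levelField (N : ℕ+) : (Z.levelField N).gal = Z.level N := gal_ofOpen _ _

theorem gal_comp_levelField (L : FinExt k Ω) (N : ℕ+) :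
    (comp L (Z.levelField N)).gal = L.gal ⊓ Z.level N := by rw [gal_comp, gal_levelField]

theorem normalOver_levelField (F : FinExt k Ω) (N : ℕ+) : F.NormalOver (Z.levelField N) := by
  rw [normalOver_iff]
  intro g _ h hh
  rw [gal_levelField] at hh ⊢
  exact level_normal_of.conj_mem h hh g

theorem resDeg_comp_levelField {L : FinExt k Ω} {N : ℕ+} (h : Z.resDeg L ∣ N) :
    Z.resDeg (comp L (Z.levelField N)) = N := by
  apply resDeg_eq_of_sup
  rw [gal_comp_levelField]
  apply le_antisymm (sup_le inf_le_right (inertia_le_level N))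
  intro g hg
  obtain ⟨l, hl, hd⟩ := exists_mem_gal_deg_eq (F := L) (level_le h hg)
  have h1 : l⁻¹ * g ∈ Z.inertia := by
    rw [← deg_eq_zero_iff, deg_mul, deg_inv, hd]; simp
  have h2 : l ∈ Z.level N := by rwa [mem_level, hd]
  have := Subgroup.mul_mem_sup (S := L.gal ⊓ Z.level N) ⟨hl, h2⟩ h1
  simpa using this

/-! ### The fixed field of a Frobenius lift -/

section FixedIn

variable {F L : FinExt k Ω} (h : F ≤ L) (hL : F.NormalOver L) {τ : Gal(Ω/k)} (hτF : τ ∈ F.gal)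
  {ν : ℕ+} (hτ : Z.deg τ = (ν : ℕ)) {N : ℕ+} (hN : degree h * ν ∣ N)

include h hL hτF hτ hN

/-- Here N divides jν, so |L:F| divides j and Lagrange's theorem applies. -/
theorem zpow_mem_gal_of_mem_level {j : ℤ} (hj : τ ^ j ∈ Z.level N) : τ ^ j ∈ L.gal := by
  rw [zpow_mem_level_iff hτ] at hj
  have h1 : ((degree h : ℕ) : ℤ) * ν ∣ j * ν := dvd_trans (by exact_mod_cast hN) hj
  obtain ⟨c, hc⟩ := Int.dvd_of_mul_dvd_mul_right (by exact_mod_cast ν.ne_zero) h1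
  rw [hc, zpow_mul, zpow_natCast]
  exact zpow_mem (pow_degree_mem h hL hτF dvd_rfl) c

/-- The group generated by τ and G_L ∩ level N stops shrinking once |L:F|ν divides N: the power of τ
that has to be split off is in level N, hence in G_L. -/
theorem inf_level_le_zpowers_sup {N' : ℕ+} (hNN : (N : ℕ) ∣ N') :
    L.gal ⊓ Z.level N ≤ Subgroup.zpowers τ ⊔ (L.gal ⊓ Z.level N') := by
  rintro g ⟨hg, hgN⟩
  have hν : (ν : ℕ) ∣ N := dvd_trans (dvd_mul_left _ _) hN
  obtain ⟨c, hc⟩ := exists_zpow_mul_mem_level hτ (level_le hν hgN) (hν.trans hNN)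
  have h1 : τ ^ c ∈ Z.level N := by
    have := (Z.level N).mul_mem ((Z.level N).inv_mem (level_le hNN hc)) hgN
    simpa using this
  have h2 := zpow_mem_gal_of_mem_level h hL hτF hτ hN h1
  have h3 : g * (τ ^ c)⁻¹ ∈ L.gal := mul_mem hg (inv_mem h2)
  have := mul_mem (Subgroup.mem_sup_right (S := Subgroup.zpowers τ) (T := L.gal ⊓ Z.level N')
    ⟨h3, hc⟩) (Subgroup.mem_sup_left (T := L.gal ⊓ Z.level N')
    (zpow_mem (Subgroup.mem_zpowers τ) c))
  simpa using this

/-- By compactness an element of L_pur lies in Lk_{N₁} for some N₁. Enlarging N to N·N₁ does not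
change the group on the right, so N already serves all elements. -/
theorem fixedIn_eq : Z.fixedIn L τ = fixedField (Subgroup.zpowers τ ⊔ (L.gal ⊓ Z.level N)) := by
  apply le_antisymm
  · intro x hx
    have h1 : k⟮x⟯ ≤ Z.fixedIn L τ := adjoin_simple_le_iff.2 hx
    suffices k⟮x⟯ ≤ fixedField (Subgroup.zpowers τ ⊔ (L.gal ⊓ Z.level N)) from
      adjoin_simple_le_iff.1 this
    have hx1 : k⟮x⟯ ≤ Z.purOver L := h1.trans inf_le_left
    have hx2 : k⟮x⟯ ≤ fixedField (Subgroup.zpowers τ) := h1.trans inf_le_right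
    rw [IntermediateField.le_iff_le] at hx2 ⊢
    refine sup_le hx2 ?_
    have hfin : FiniteDimensional k k⟮x⟯ :=
      adjoin.finiteDimensional (Algebra.IsIntegral.isIntegral x)
    obtain ⟨N₁, hN₁⟩ := exists_level_le (Z := Z) (C := L.gal)
      (Subgroup.isClosed_of_isOpen _ L.gal_isOpen) (fixingSubgroup_isOpen k⟮x⟯) (by
        have := fixingSubgroup_le hx1
        rwa [purOver, IntermediateField.fixingSubgroup_sup] at this)
    refine (inf_level_le_zpowers_sup h hL hτF hτ hN (N' := N * N₁) (by simp)).trans ?_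
    refine sup_le hx2 (le_trans ?_ hN₁)
    exact inf_le_inf_left _ (level_le (by simp))
  · refine le_inf ?_ (fixedField_le le_sup_left)
    rw [← InfiniteGalois.fixedField_fixingSubgroup (Z.purOver L)]
    apply fixedField_le
    rw [purOver, IntermediateField.fixingSubgroup_sup]
    exact le_trans (inf_le_inf_left _ (inertia_le_level N)) le_sup_right

theorem gal_fixedIn {S : FinExt k Ω} (hS : S.1 = Z.fixedIn L τ) :
    S.gal = Subgroup.zpowers τ ⊔ (L.gal ⊓ Z.level N) := by
  rw [gal, hS, fixedIn_eq h hL hτF hτ hN,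
    fixingSubgroup_fixedField_of_isOpen (zpowers_sup_isOpen L τ N)]

/-- The join is a product set because τ normalizes G_L ∩ level N. -/
theorem mem_gal_fixedIn {S : FinExt k Ω} (hS : S.1 = Z.fixedIn L τ) {g : Gal(Ω/k)} :
    g ∈ S.gal ↔ ∃ j : ℤ, ∃ d ∈ L.gal ⊓ Z.level N, τ ^ j * d = g := by
  have hn : Subgroup.zpowers τ ≤
      Subgroup.normalizer ((L.gal ⊓ Z.level N : Subgroup Gal(Ω/k)) : Set Gal(Ω/k)) := by
    have hM : F.NormalOver (comp L (Z.levelField N)) := hL.comp (normalOver_levelField F N)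
    rw [Subgroup.zpowers_le, Subgroup.mem_normalizer_iff, ← gal_comp_levelField]
    refine fun g => ⟨fun hg => hM.conj_mem hτF hg, fun hg => ?_⟩
    simpa [mul_assoc] using hM.conj_mem (inv_mem hτF) hg
  rw [gal_fixedIn h hL hτF hτ hN hS, ← SetLike.mem_coe,
    Subgroup.coe_mul_of_left_le_normalizer_right _ _ hn, Set.mem_mul]
  constructor
  · rintro ⟨_, ⟨j, rfl⟩, d, hd, rfl⟩
    exact ⟨j, d, hd, rfl⟩
  · rintro ⟨j, d, hd, rfl⟩
    exact ⟨_, ⟨j, rfl⟩, d, hd, rfl⟩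

/-- The finite-level form of Σ_pur = L_pur, namely Σk_N = Lk_N. -/
theorem gal_fixedIn_inf_level {S : FinExt k Ω} (hS : S.1 = Z.fixedIn L τ) :
    S.gal ⊓ Z.level N = L.gal ⊓ Z.level N := by
  apply le_antisymm
  · rintro g ⟨hg, hgN⟩
    refine ⟨?_, hgN⟩
    obtain ⟨j, d, hd, rfl⟩ := (mem_gal_fixedIn h hL hτF hτ hN hS).1 hg
    refine mul_mem (zpow_mem_gal_of_mem_level h hL hτF hτ hN (j := j) ?_) hd.1
    have := (Z.level N).mul_mem hgN ((Z.level N).inv_mem hd.2)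
    simpa using this
  · refine le_inf ?_ inf_le_right
    rw [gal_fixedIn h hL hτF hτ hN hS]
    exact le_sup_right

omit hN

theorem exists_fixedIn : ∃ S : FinExt k Ω, F ≤ S ∧ S.1 = Z.fixedIn L τ := by
  let N : ℕ+ := ⟨degree h * ν, Nat.mul_pos (degree_pos h) ν.pos⟩
  have hN : degree h * ν ∣ N := dvd_rfl
  have ho := zpowers_sup_isOpen (Z := Z) L τ N
  refine ⟨ofOpen _ ho, le_of_gal_le ?_, (fixedIn_eq h hL hτF hτ hN).symm⟩
  rw [gal_ofOpen]
  exact sup_le ((Subgroup.zpowers_le).2 hτF) (inf_le_left.trans (gal_le h))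

theorem mem_gal_of_fixedIn {S : FinExt k Ω} (hS : S.1 = Z.fixedIn L τ) : τ ∈ S.gal := by
  let N : ℕ+ := ⟨degree h * ν, Nat.mul_pos (degree_pos h) ν.pos⟩
  have hN : degree h * ν ∣ N := dvd_rfl
  rw [gal_fixedIn h hL hτF hτ hN hS]
  exact Subgroup.mem_sup_left (Subgroup.mem_zpowers τ)

theorem resDeg_fixedIn {S : FinExt k Ω} (hS : S.1 = Z.fixedIn L τ) : Z.resDeg S = ν := by
  -- The extra factor f_L makes Lk_N have residue degree exactly N.
  let N : ℕ+ := ⟨degree h * ν * Z.resDeg L,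
    Nat.mul_pos (Nat.mul_pos (degree_pos h) ν.pos) (Z.resDeg_pos L)⟩
  have hN : degree h * ν ∣ N := Dvd.intro _ rfl
  have hν : (ν : ℕ) ∣ N := dvd_trans (dvd_mul_left _ _) hN
  apply resDeg_eq_of_sup
  have hτS := mem_gal_of_fixedIn h hL hτF hτ hS
  apply le_antisymm
  · rw [gal_fixedIn h hL hτF hτ hN hS]
    refine sup_le (sup_le ?_ (inf_le_right.trans (level_le hν))) (inertia_le_level ν)
    exact (Subgroup.zpowers_le).2 (mem_level_of_natCast hτ dvd_rfl)
  · intro g hg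
    obtain ⟨c, hc⟩ := exists_zpow_mul_mem_level hτ hg hν
    have h1 : Z.level N ≤ S.gal ⊔ Z.inertia := by
      have h2 := Z.gal_sup_inertia (comp L (Z.levelField N))
      have h3 : Z.resDegP (comp L (Z.levelField N)) = N :=
        PNat.eq (resDeg_comp_levelField (Dvd.intro_left _ rfl))
      rw [h3] at h2
      rw [← h2, gal_comp_levelField, ← gal_fixedIn_inf_level h hL hτF hτ hN hS]
      exact sup_le_sup_right inf_le_left _
    have := mul_mem (h1 hc) (Subgroup.mem_sup_left (T := Z.inertia) (zpow_mem hτS c))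
    simpa using this

theorem gal_fixedIn_inf_inertia {S : FinExt k Ω} (hS : S.1 = Z.fixedIn L τ) :
    S.gal ⊓ Z.inertia ≤ L.gal := by
  let N : ℕ+ := ⟨degree h * ν, Nat.mul_pos (degree_pos h) ν.pos⟩
  have hN : degree h * ν ∣ N := dvd_rfl
  exact (inf_le_inf_left _ (inertia_le_level N)).trans
    ((gal_fixedIn_inf_level h hL hτF hτ hN hS).le.trans inf_le_left)

end FixedIn

end ZHatExtension

/-! ### Restriction from G_F to Gal(L/F) -/

namespace FinExt

variable {k : Type u} {Ω : Type v} [Field k] [Field Ω] [Algebra k Ω]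

theorem mem_of_extends {F L : FinExt k Ω} {h : F ≤ L} {g : Gal(Ω/k)} {σ : GalGroup h}
    (hg : Extends h g σ) : g ∈ F.gal := by
  rw [IntermediateField.mem_fixingSubgroup_iff]
  intro x hx
  have h1 := hg (algebraMap F.1 (relExt h) ⟨x, hx⟩)
  rw [AlgEquiv.commutes] at h1
  exact h1

variable [IsGalois k Ω]

/-- Restriction of automorphisms to a Galois extension `L/F`. -/
noncomputable def resHom {F L : FinExt k Ω} (h : F ≤ L) (hL : F.NormalOver L) :
    F.gal →* GalGroup h :=
  have := isGalois_of_normalOver h hL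
  (AlgEquiv.restrictNormalHom (relExt h)).comp
    (IntermediateField.fixingSubgroupEquiv F.1).toMonoidHom

theorem extends_resHom {F L : FinExt k Ω} (h : F ≤ L) (hL : F.NormalOver L) (g : F.gal) :
    Extends h g (resHom h hL g) := fun x => by
  have := isGalois_of_normalOver h hL
  exact (AlgEquiv.restrictNormal_commutes
    (IntermediateField.fixingSubgroupEquiv F.1 g) (relExt h) x).symm

theorem extends_iff {F L : FinExt k Ω} (h : F ≤ L) (hL : F.NormalOver L) {g : Gal(Ω/k)}
    {σ : GalGroup h} : Extends h g σ ↔ ∃ hg : g ∈ F.gal, resHom h hL ⟨g, hg⟩ = σ := by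
  constructor
  · intro hg
    refine ⟨mem_of_extends hg, ?_⟩
    ext x
    exact ((extends_resHom h hL ⟨g, mem_of_extends hg⟩) x).symm.trans (hg x)
  · rintro ⟨hg, rfl⟩
    exact extends_resHom h hL ⟨g, hg⟩

theorem resHom_eq_iff {F L : FinExt k Ω} (h : F ≤ L) (hL : F.NormalOver L) {g g' : F.gal} :
    resHom h hL g = resHom h hL g' ↔ ((g' : Gal(Ω/k))⁻¹ * g) ∈ L.gal := by
  rw [← ext_iff_gal]
  constructor
  · intro e x hx
    exact (extends_resHom h hL g ⟨x, hx⟩).trans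
      ((congrArg (fun s => (s ⟨x, hx⟩ : Ω)) e).trans (extends_resHom h hL g' ⟨x, hx⟩).symm)
  · intro e
    ext x
    exact (extends_resHom h hL g x).symm.trans ((e x x.2).trans (extends_resHom h hL g' x))

theorem ker_resHom {F L : FinExt k Ω} (h : F ≤ L) (hL : F.NormalOver L) :
    (resHom h hL).ker = L.gal.subgroupOf F.gal := by
  ext g
  rw [MonoidHom.mem_ker, ← map_one (resHom h hL), resHom_eq_iff, Subgroup.mem_subgroupOf]
  simp

theorem resDeg_dvd_resDeg_conj (Z : ZHatExtension k Ω) (F : FinExt k Ω) (g : Gal(Ω/k)) :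
    Z.resDeg F ∣ Z.resDeg (F.conj g) := by
  rw [Z.resDeg_eq_index (F.conj g), ← Z.coe_resDegP, ← Z.index_level (Z.resDegP F)]
  refine Subgroup.index_dvd_of_le (sup_le ?_ (Z.inertia_le_level _))
  intro x hx
  rw [mem_gal_conj] at hx
  have := Z.gal_le_level F hx
  have h2 := ZHatExtension.level_normal_of.conj_mem _ this g
  simpa [mul_assoc] using h2

theorem resDeg_conj (Z : ZHatExtension k Ω) (F : FinExt k Ω) (g : Gal(Ω/k)) :
    Z.resDeg (F.conj g) = Z.resDeg F := by
  refine Nat.dvd_antisymm ?_ (resDeg_dvd_resDeg_conj Z F g)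
  have := resDeg_dvd_resDeg_conj Z (F.conj g) g⁻¹
  rwa [← conj_mul, inv_mul_cancel, conj_one] at this

end FinExt

namespace FinExt

variable {k : Type u} {Ω : Type v} [Field k] [Field Ω] [Algebra k Ω] [IsSepClosure k Ω]

theorem resHom_surjective {F L : FinExt k Ω} (h : F ≤ L) (hL : F.NormalOver L) :
    Function.Surjective (resHom h hL) := fun σ => by
  obtain ⟨hg, e⟩ := (extends_iff h hL).1 (extends_lift h σ)
  exact ⟨_, e⟩

theorem zpowers_resHom_eq_top {F L : FinExt k Ω} (h : F ≤ L) (hL : F.NormalOver L) (φ : F.gal)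
    (hgen : ∀ g ∈ F.gal, ∃ j : ℤ, ((φ : Gal(Ω/k)) ^ j)⁻¹ * g ∈ L.gal) :
    Subgroup.zpowers (resHom h hL φ) = ⊤ := by
  rw [eq_top_iff]
  intro σ _
  obtain ⟨g, rfl⟩ := resHom_surjective h hL σ
  obtain ⟨j, hj⟩ := hgen g g.2
  refine ⟨j, ?_⟩
  change resHom h hL φ ^ j = resHom h hL g
  rw [← map_zpow, eq_comm, resHom_eq_iff]
  exact hj

end FinExt

/-! ### The Galois action on A_M, and (A3) in terms of it -/

namespace MackeyFunctor

open FinExt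

variable {k : Type u} {Ω : Type v} [Field k] [Field Ω] [Algebra k Ω]
  (A : MackeyFunctor.{u, v, w} k Ω)

theorem conj_congr {F F' : FinExt k Ω} {g g' : Gal(Ω/k)} (h : F' = F.conj g)
    (h' : F' = F.conj g') (hg : g'⁻¹ * g ∈ F.gal) (a : A.obj F) :
    A.conj g h a = A.conj g' h' a := by
  have h1 := A.conj_conj (g'⁻¹ * g) g' (FinExt.conj_of_mem hg) h' (by simpa using h) a
  rw [A.conj_of_mem _ _ hg] at h1
  rw [h1]
  congr 2
  simp

/-- The action of `Gal(Ω/F)` on `A_M`, for `M` stable under `Gal(Ω/F)`. -/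
def rep {F M : FinExt k Ω} (hM : F.NormalOver M) : F.gal →* AddMonoid.End (A.obj M) where
  toFun g := A.conj g (hM g g.2)
  map_one' := by
    ext a
    exact A.conj_of_mem _ _ (one_mem _) a
  map_mul' g h := by
    ext a
    exact (A.conj_conj (h : Gal(Ω/k)) (g : Gal(Ω/k)) _ _ _ a).symm

theorem rep_apply {F M : FinExt k Ω} (hM : F.NormalOver M) (g : F.gal) (a : A.obj M) :
    A.rep hM g a = A.conj g (hM g g.2) a := rfl

theorem rep_of_mem {F M : FinExt k Ω} (hM : F.NormalOver M) {g : F.gal}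
    (hg : (g : Gal(Ω/k)) ∈ M.gal) : A.rep hM g = 1 := by
  ext a
  exact A.conj_of_mem _ _ hg a

theorem norm_rep {F M M' : FinExt k Ω} (hM : F.NormalOver M) (hM' : F.NormalOver M')
    (h : M ≤ M') (g : F.gal) (a : A.obj M') :
    A.norm h (A.rep hM' g a) = A.rep hM g (A.norm h a) :=
  (A.conj_norm g h h _ _ a).symm

section

variable [IsSepClosure k Ω]

/-- The lift chosen inside `act` differs from φ by an element of G_L, which acts trivially. -/
theorem oneSub_resHom {F L : FinExt k Ω} (h : F ≤ L) (hL : F.NormalOver L) (φ : F.gal)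
    (a : A.obj L) : A.oneSub h (resHom h hL φ) a = a - A.rep hL φ a := by
  have : A.act h (resHom h hL φ) a = A.rep hL φ a := by
    refine A.conj_congr _ _ ?_ a
    obtain ⟨hg, e⟩ := (extends_iff h hL).1 (extends_lift h (resHom h hL φ))
    exact (resHom_eq_iff h hL).1 e
  rw [oneSub, AddMonoidHom.sub_apply, this]
  rfl

variable {A} {Z : ZHatExtension k Ω} (hA3 : AxiomA3 A Z) {F L : FinExt k Ω} (h : F ≤ L)
  (hL : F.NormalOver L) (hun : F.gal ⊓ Z.inertia ≤ L.gal) (φ : F.gal)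
  (hgen : ∀ g ∈ F.gal, ∃ j : ℤ, ((φ : Gal(Ω/k)) ^ j)⁻¹ * g ∈ L.gal)

include hA3 hL hun hgen

theorem res_injective_of_A3 : Function.Injective (A.res h) :=
  ((hA3 F L h (Z.le_purOver_iff.2 hun)).2 _ (zpowers_resHom_eq_top h hL φ hgen)).1.1

theorem exists_res_eq_of_A3 {a : A.obj L} (ha : A.rep hL φ a = a) : ∃ b, A.res h b = a := by
  refine (((hA3 F L h (Z.le_purOver_iff.2 hun)).2 _
    (zpowers_resHom_eq_top h hL φ hgen)).1.2 a).1 ?_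
  rw [oneSub_resHom, ha, sub_self]

theorem exists_sub_eq_of_A3 {a : A.obj L} (ha : A.norm h a = 0) : ∃ b, b - A.rep hL φ b = a := by
  obtain ⟨b, hb⟩ := (((hA3 F L h (Z.le_purOver_iff.2 hun)).2 _
    (zpowers_resHom_eq_top h hL φ hgen)).2 a).1 ha
  exact ⟨b, (A.oneSub_resHom h hL φ b) ▸ hb⟩

end

end MackeyFunctor

/-! ### Valuations and unramified norms -/

namespace ClassValuation

open FinExt

variable {k : Type u} {Ω : Type v} [Field k] [Field Ω] [Algebra k Ω]
  {A : MackeyFunctor.{u, v, w} k Ω} {Z : ZHatExtension k Ω} (V : ClassValuation A Z)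

theorem resDeg_mul_valOver (L : FinExt k Ω) (a : A.obj L) :
    Z.resDeg L * V.valOver L a = V.val (A.norm L.ground_le a) :=
  Int.mul_ediv_cancel' (V.dvd L a)

theorem resDeg_mul_valOver_norm {F L : FinExt k Ω} (h : F ≤ L) (b : A.obj L) :
    Z.resDeg F * V.valOver F (A.norm h b) = Z.resDeg L * V.valOver L b := by
  rw [resDeg_mul_valOver, resDeg_mul_valOver, A.norm_norm]

variable [IsGalois k Ω]

theorem resDeg_ne_zero (F : FinExt k Ω) : (Z.resDeg F : ℤ) ≠ 0 := by
  exact_mod_cast (Z.resDeg_pos F).ne'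

theorem valOver_surjective (L : FinExt k Ω) : Function.Surjective (V.valOver L) := by
  intro n
  obtain ⟨b, hb⟩ := V.surjective n
  have h : (Z.resDeg L : ℤ) * n ∈ (A.normGroup L.ground_le).map V.val := by
    rw [V.map_norm L]
    exact ⟨n, ⟨b, hb⟩, rfl⟩
  obtain ⟨_, ⟨a, rfl⟩, ha⟩ := h
  refine ⟨a, ?_⟩
  rw [← resDeg_mul_valOver] at ha
  exact mul_left_cancel₀ (resDeg_ne_zero L) ha

theorem exists_isPrimeElement (L : FinExt k Ω) : ∃ ϖ, V.IsPrimeElement L ϖ :=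
  V.valOver_surjective L 1

theorem valOver_conj {F F' : FinExt k Ω} (g : Gal(Ω/k)) (h : F' = F.conj g) (a : A.obj F) :
    V.valOver F' (A.conj g h a) = V.valOver F a := by
  have h1 := V.resDeg_mul_valOver F' (A.conj g h a)
  rw [← A.conj_norm g F.ground_le F'.ground_le (conj_ground g).symm h,
    A.conj_of_mem _ _ (by rw [← gal, gal_ground]; trivial), ← resDeg_mul_valOver] at h1
  have h2 : Z.resDeg F' = Z.resDeg F := by rw [h, resDeg_conj]
  rw [h2] at h1
  exact mul_left_cancel₀ (resDeg_ne_zero F) h1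

theorem valOver_rep {F M : FinExt k Ω} (hM : F.NormalOver M) (g : F.gal) (a : A.obj M) :
    V.valOver M (A.rep hM g a) = V.valOver M a := V.valOver_conj _ _ a

/-- Unramified means |M:F| f_F = f_M, which cancels the factor |M:F| coming from N∘i. -/
theorem valOver_res {F M : FinExt k Ω} (h : F ≤ M) (hun : F.gal ⊓ Z.inertia ≤ M.gal)
    (a : A.obj F) : V.valOver M (A.res h a) = V.valOver F a := by
  have h1 := V.resDeg_mul_valOver_norm h (A.res h a)
  rw [A.norm_res, map_nsmul, ← Z.degree_mul_resDeg h hun] at h1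
  refine mul_left_cancel₀ (resDeg_ne_zero (Z := Z) M) ?_
  rw [← Z.degree_mul_resDeg h hun, ← h1, nsmul_eq_mul]
  push_cast
  ring

/-- Norms from L have valuation divisible by |L:F|. The elements with this property form a subgroup
of index |L:F|, which by (A3)(a) is also the index of the norm group, so the two coincide. -/
theorem exists_norm_eq [IsSepClosure k Ω] (hA3 : AxiomA3 A Z) {F L : FinExt k Ω} (h : F ≤ L)
    (hun : F.gal ⊓ Z.inertia ≤ L.gal) {a : A.obj F} (ha : V.valOver F a = 0) :
    ∃ b, A.norm h b = a ∧ V.valOver L b = 0 := by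
  have hdeg := Z.degree_mul_resDeg h hun
  have hv : ∀ b, V.valOver F (A.norm h b) = degree h * V.valOver L b := by
    intro b
    refine mul_left_cancel₀ (resDeg_ne_zero (Z := Z) F) ?_
    rw [resDeg_mul_valOver_norm, ← hdeg]
    push_cast
    ring
  have hmem : a ∈ A.normGroup h := by
    let C : AddSubgroup (A.obj F) := (AddSubgroup.zmultiples (degree h : ℤ)).comap (V.valOver F)
    have hC : C.index = degree h := by
      rw [AddSubgroup.index_comap_of_surjective _ (V.valOver_surjective F), Int.index_zmultiples]
      simp
    have hle : A.normGroup h ≤ C := by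
      rintro _ ⟨b, rfl⟩
      rw [AddSubgroup.mem_comap, hv, Int.mem_zmultiples_iff]
      exact dvd_mul_right _ _
    have hi := (hA3 F L h (Z.le_purOver_iff.2 hun)).1
    have h1 := AddSubgroup.relIndex_mul_index hle
    rw [hC, hi] at h1
    have h2 : C ≤ A.normGroup h := by
      rw [← AddSubgroup.relIndex_eq_one]
      exact Nat.eq_of_mul_eq_mul_right (degree_pos h) (h1.trans (one_mul _).symm)
    apply h2
    rw [AddSubgroup.mem_comap, ha]
    exact zero_mem _
  obtain ⟨b, hb⟩ := hmem
  refine ⟨b, hb, ?_⟩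
  have h1 := hv b
  have hb' : A.norm h b = a := hb
  rw [hb', ha] at h1
  have h3 : (degree h : ℤ) ≠ 0 := by exact_mod_cast (degree_pos h).ne'
  exact (mul_eq_zero.1 h1.symm).resolve_left h3

end ClassValuation

/-! ### Double cosets over an unramified base -/

namespace MackeyFunctor

open FinExt ZHatExtension

variable {k : Type u} {Ω : Type v} [Field k] [Field Ω] [Algebra k Ω]
  (A : MackeyFunctor.{u, v, w} k Ω) {Z : ZHatExtension k Ω}

theorem norm_res_conj_eq {F W S M : FinExt k Ω} (hM : F.NormalOver M) (hWM : W ≤ M)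
    (hSM : S ≤ M) (t : F.gal) (hMe : M = comp W (S.conj t)) (a : A.obj S) :
    A.norm (left_le_comp W (S.conj t)) (A.res (right_le_comp W (S.conj t)) (A.conj t rfl a)) =
      A.norm hWM (A.rep hM t (A.res hSM a)) := by
  -- The compositum equals `M` only propositionally, so it is made a variable before substitution.
  have key : ∀ (M' : FinExt k Ω) (h1 : W ≤ M') (h2 : S.conj t ≤ M'), M = M' →
      A.norm h1 (A.res h2 (A.conj t rfl a)) = A.norm hWM (A.rep hM t (A.res hSM a)) := by
    rintro M' h1 h2 rfl
    rw [rep_apply, A.conj_res (t : Gal(Ω/k)) hSM h2 rfl (hM t t.2)]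
  exact key _ _ _ hMe

variable [IsGalois k Ω]

/-- The double coset formula for the unramified extension `W = F k_N` of `F` and an extension
`S/F` whose degree map has image generated by `ν = n f_F`. -/
theorem res_norm_eq_sum {F S M W : FinExt k Ω} (hS : F ≤ S) (hW : F ≤ W) (hWM : W ≤ M)
    (hSM : S ≤ M) (hM : F.NormalOver M) {N ν : ℕ+} {n : ℕ}
    (hWg : W.gal = F.gal ⊓ Z.level N) (hMg : M.gal = S.gal ⊓ Z.level N)
    (φ : F.gal) (hφ : Z.deg (φ : Gal(Ω/k)) = Z.resDeg F) {τ : Gal(Ω/k)} (hτS : τ ∈ S.gal)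
    (hτ : Z.deg τ = (ν : ℕ)) (hSν : S.gal ≤ Z.level ν) (hn : (ν : ℕ) = n * Z.resDeg F)
    (hνN : (ν : ℕ) ∣ N) (a : A.obj S) :
    A.res hW (A.norm hS a) =
      A.norm hWM (∑ j ∈ Finset.range n, (A.rep hM φ ^ j) (A.res hSM a)) := by
  classical
  have hf : (0 : ℤ) < Z.resDeg F := by exact_mod_cast Z.resDeg_pos F
  have hn0 : 0 < n := by
    rcases Nat.eq_zero_or_pos n with rfl | h0
    · simp at hn
    · exact h0
  have hφz : ∀ (c : ℤ) (m : ℕ+), (φ : Gal(Ω/k)) ^ c ∈ Z.level m ↔ (m : ℤ) ∣ c * Z.resDeg F :=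
    fun c m => zpow_mem_level_iff hφ
  have hφν : ∀ i j : ℕ, (φ : Gal(Ω/k)) ^ i * ((φ : Gal(Ω/k)) ^ j)⁻¹ ∈ Z.level ν →
      (n : ℤ) ∣ (i : ℤ) - j := by
    intro i j hij
    have h1 : (φ : Gal(Ω/k)) ^ i * ((φ : Gal(Ω/k)) ^ j)⁻¹ = (φ : Gal(Ω/k)) ^ ((i : ℤ) - j) := by
      rw [zpow_sub, zpow_natCast, zpow_natCast]
    rw [h1, hφz, hn] at hij
    push_cast at hij
    exact Int.dvd_of_mul_dvd_mul_right hf.ne' hij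
  have hinj : ∀ i ∈ Finset.range n, ∀ j ∈ Finset.range n,
      (n : ℤ) ∣ (i : ℤ) - j → i = j := by
    intro i hi j hj hij
    rw [Finset.mem_range] at hi hj
    have := Int.eq_zero_of_abs_lt_dvd hij (by rw [abs_lt]; omega)
    omega
  -- The double cosets of G_W and G_S in G_F are separated by the degree modulo ν = n f_F, so φ^j
  -- with j < n represent them.
  rw [A.double_coset hS hW ((Finset.range n).image fun j => (φ : Gal(Ω/k)) ^ j), map_sum,
    Finset.sum_image]
  · refine Finset.sum_congr rfl fun j _ => ?_
    have := A.norm_res_conj_eq hM hWM hSM (φ ^ j) ?_ a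
    · rw [← map_pow]
      exact this
    · apply eq_of_gal_eq
      rw [gal_comp, hWg]
      ext x
      rw [Subgroup.mem_inf, mem_gal_conj]
      have h3 := hM _ (φ ^ j).2
      conv_rhs => rw [h3, mem_gal_conj]
      rw [hMg]
      have h4 : (((φ ^ j : F.gal) : Gal(Ω/k)))⁻¹ * x * ((φ ^ j : F.gal) : Gal(Ω/k)) ∈ Z.level N ↔
          x ∈ Z.level N := by
        have := deg_conj Z (((φ ^ j : F.gal) : Gal(Ω/k)))⁻¹ x
        rw [inv_inv] at this
        rw [mem_level, this, mem_level]
      constructor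
      · rintro ⟨⟨_, h1⟩, h2⟩
        exact ⟨h2, h4.2 h1⟩
      · rintro ⟨h2, h1⟩
        refine ⟨⟨?_, h4.1 h1⟩, h2⟩
        have := F.gal.mul_mem (F.gal.mul_mem (φ ^ j).2 (gal_le hS h2)) (F.gal.inv_mem (φ ^ j).2)
        simpa [mul_assoc] using this
  · intro i hi j hj hij
    refine hinj i hi j hj (hφν i j ?_)
    have hij : (φ : Gal(Ω/k)) ^ i = (φ : Gal(Ω/k)) ^ j := hij
    rw [hij, mul_inv_cancel]
    exact one_mem _
  · intro t ht
    obtain ⟨j, _, rfl⟩ := Finset.mem_image.1 ht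
    exact pow_mem φ.2 j
  · intro g hg
    obtain ⟨a, ha⟩ := ZHat.exists_int (Z.deg g) N
    have hfN : Z.resDeg F ∣ N := dvd_trans (Dvd.intro_left _ hn.symm) hνN
    have h1 := gal_le_level (Z := Z) F hg
    rw [mem_level, ha (Z.resDegP F) hfN, ZMod.intCast_zmod_eq_zero_iff_dvd] at h1
    obtain ⟨b, rfl⟩ := h1
    have hbn : 0 ≤ b % n := Int.emod_nonneg _ (by exact_mod_cast hn0.ne')
    have hbl : b % n < n := Int.emod_lt_of_pos _ (by exact_mod_cast hn0)
    -- At level N the degree of g is b f_F. The quotient b / n is absorbed by a power of τ, and the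
    -- remainder picks the representative.
    refine ⟨(φ : Gal(Ω/k)) ^ (b % n).toNat, ⟨Finset.mem_image.2
      ⟨_, Finset.mem_range.2 (by omega), rfl⟩, ?_⟩, ?_⟩
    · rw [DoubleCoset.mem_doubleCoset]
      refine ⟨g * (τ ^ (b / n))⁻¹ * ((φ : Gal(Ω/k)) ^ (b % n).toNat)⁻¹, ?_, τ ^ (b / n),
        zpow_mem hτS _, by group⟩
      change _ ∈ W.gal
      rw [hWg]
      refine ⟨F.gal.mul_mem (F.gal.mul_mem hg (F.gal.inv_mem (F.gal.zpow_mem (gal_le hS hτS) _)))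
        (F.gal.inv_mem (F.gal.pow_mem φ.2 _)), ?_⟩
      change _ ∈ Z.level N
      rw [mem_level, deg_mul, deg_mul, deg_inv, deg_inv, deg_zpow, deg_pow, hτ, hφ]
      have h2 : (Z.deg g).1 N + -((b / n) • (((ν : ℕ) : ZHat)).1 N) +
          -((b % n).toNat • (((Z.resDeg F : ℕ) : ZHat)).1 N) = 0 := by
        rw [ha N dvd_rfl, natCast_val_apply, natCast_val_apply, hn, zsmul_eq_mul, nsmul_eq_mul]
        have h3 : (((b % n).toNat : ℤ) : ZMod N) = ((b % n : ℤ) : ZMod N) := by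
          rw [Int.toNat_of_nonneg hbn]
        rw [Int.cast_natCast] at h3
        rw [h3]
        have h4 : ((b : ℤ) : ZMod N) = ((b % n + n * (b / n) : ℤ) : ZMod N) := by
          rw [Int.emod_add_mul_ediv]
        rw [coe_resDegP, Int.cast_mul, h4]
        push_cast
        ring
      exact h2
    · rintro t ⟨ht, htd⟩
      obtain ⟨j, hj, rfl⟩ := Finset.mem_image.1 ht
      rw [DoubleCoset.mem_doubleCoset] at htd
      obtain ⟨x, hx, y, hy, hxy⟩ := htd
      have hx : x ∈ W.gal := hx
      have hy : y ∈ S.gal := hy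
      rw [hWg] at hx
      have hxν := level_le hνN hx.2
      have hyν := hSν hy
      have h5 : (Z.deg g).1 ν = j * Z.resDeg F := by
        rw [hxy, deg_mul, deg_mul, deg_pow, hφ]
        have h6 : (Z.deg x).1 ν + j • (((Z.resDeg F : ℕ) : ZHat)).1 ν + (Z.deg y).1 ν =
            j * Z.resDeg F := by
          rw [mem_level.1 hxν, mem_level.1 hyν, natCast_val_apply, nsmul_eq_mul]
          ring
        exact h6
      have h7 : (n : ℤ) ∣ (j : ℤ) - b := by
        rw [ha ν hνN] at h5
        have h8 : ((((j : ℤ) - b) * Z.resDeg F : ℤ) : ZMod ν) = 0 := by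
          push_cast
          push_cast at h5
          rw [coe_resDegP] at h5
          rw [sub_mul, ← h5]
          ring
        rw [ZMod.intCast_zmod_eq_zero_iff_dvd, hn] at h8
        push_cast at h8
        exact Int.dvd_of_mul_dvd_mul_right hf.ne' h8
      have h9 : j = (b % n).toNat := by
        refine hinj j hj _ (Finset.mem_range.2 (by omega)) ?_
        rw [Int.toNat_of_nonneg hbn]
        have h10 : (n : ℤ) ∣ b - b % n := Int.dvd_self_sub_emod
        have := dvd_add h7 h10
        simpa using this
      rw [h9]

end MackeyFunctor

namespace ZHatExtension

open FinExt

variable {k : Type u} {Ω : Type v} [Field k] [Field Ω] [Algebra k Ω]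
  {Z : ZHatExtension k Ω}

theorem exists_zpow_inv_mul_mem {F : FinExt k Ω} {τ : Gal(Ω/k)} {ν N : ℕ+} (hτF : τ ∈ F.gal)
    (hτ : Z.deg τ = (ν : ℕ)) (hF : F.gal ≤ Z.level ν) (hN : (ν : ℕ) ∣ N) :
    ∀ g ∈ F.gal, ∃ j : ℤ, (τ ^ j)⁻¹ * g ∈ F.gal ⊓ Z.level N := by
  intro g hg
  obtain ⟨c, hc⟩ := exists_zpow_mul_mem_level hτ (hF hg) hN
  refine ⟨c, F.gal.mul_mem (F.gal.inv_mem (F.gal.zpow_mem hτF c)) hg, ?_⟩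
  change _ ∈ Z.level N
  rwa [mem_level, deg_mul, add_comm, ← deg_mul]

end ZHatExtension

namespace MackeyFunctor

open FinExt

variable {k : Type u} {Ω : Type v} [Field k] [Field Ω] [Algebra k Ω]
  (A : MackeyFunctor.{u, v, w} k Ω)

theorem rep_sum_sub {F M : FinExt k Ω} (hM : F.NormalOver M) (φ : F.gal) (n : ℕ) (b : A.obj M) :
    A.rep hM φ (∑ j ∈ Finset.range n, (A.rep hM φ ^ j) b) -
      ∑ j ∈ Finset.range n, (A.rep hM φ ^ j) b = (A.rep hM φ ^ n) b - b := by
  rw [map_sum, ← Finset.sum_sub_distrib]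
  have : ∀ j, A.rep hM φ ((A.rep hM φ ^ j) b) = (A.rep hM φ ^ (j + 1)) b := by
    intro j
    rw [pow_succ']
    rfl
  simp only [this]
  rw [Finset.sum_range_sub (fun j => (A.rep hM φ ^ j) b)]
  rfl

end MackeyFunctor

/-! ### Descent of a relation to the base field -/

namespace ClassValuation

open FinExt ZHatExtension MackeyFunctor

variable {k : Type u} {Ω : Type v} [Field k] [Field Ω] [Algebra k Ω] [IsSepClosure k Ω]
  {A : MackeyFunctor.{u, v, w} k Ω} {Z : ZHatExtension k Ω} (V : ClassValuation A Z)
  (hA3 : AxiomA3 A Z) {F L M W : FinExt k Ω} (h : F ≤ L) (hL : F.NormalOver L)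

include hA3 hL in
/-- The descent step behind the multiplicativity of the reciprocity map. -/
theorem mem_normGroup_of_relation (φ : F.gal) (hφ : Z.deg (φ : Gal(Ω/k)) = Z.resDeg F) {N : ℕ+}
    (hN : degree h * Z.resDeg F ∣ N)
    (hM : M = comp L (Z.levelField N)) (hW : W = comp F (Z.levelField N))
    (hMn : F.NormalOver M) (hFW : F ≤ W) (hWM : W ≤ M)
    {y : A.obj F} {x u₁ u₂ : A.obj M} {τ₁ τ₂ : F.gal} (hτ₁ : (τ₁ : Gal(Ω/k)) ∈ Z.inertia)
    (hτ₂ : (τ₂ : Gal(Ω/k)) ∈ Z.inertia) (hxy : A.norm hWM x = A.res hFW y)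
    (hx : V.valOver M x = 0) (hu₁ : V.valOver M u₁ = 0) (hu₂ : V.valOver M u₂ = 0)
    (hrel : A.rep hMn φ x - x = (A.rep hMn τ₁ u₁ - u₁) + (A.rep hMn τ₂ u₂ - u₂)) :
    y ∈ A.normGroup h := by
  have hMg : M.gal = L.gal ⊓ Z.level N := by rw [hM, gal_comp_levelField]
  have hWg : W.gal = F.gal ⊓ Z.level N := by rw [hW, gal_comp_levelField]
  have hLM : L ≤ M := le_of_gal_le (hMg ▸ inf_le_left)
  have hWN : Z.resDeg W = N := by
    rw [hW]; exact resDeg_comp_levelField (dvd_trans (dvd_mul_left _ _) hN)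
  obtain ⟨n, hn⟩ : Z.resDeg F ∣ N := dvd_trans (dvd_mul_left _ _) hN
  rw [mul_comm] at hn
  -- The factor is chosen so that |W':W| = |L:F|; multiplication by it will be read as N_{L/F}∘i.
  let N' : ℕ+ := ⟨N * degree h, Nat.mul_pos N.pos (degree_pos h)⟩
  have hNN' : (N : ℕ) ∣ N' := dvd_mul_right _ _
  let M' := comp L (Z.levelField N')
  let W' := comp F (Z.levelField N')
  have hMg' : M'.gal = L.gal ⊓ Z.level N' := gal_comp_levelField _ _
  have hWg' : W'.gal = F.gal ⊓ Z.level N' := gal_comp_levelField _ _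
  have hMM' : M ≤ M' := le_of_gal_le (by rw [hMg, hMg']; exact inf_le_inf_left _ (level_le hNN'))
  have hWW' : W ≤ W' := le_of_gal_le (by rw [hWg, hWg']; exact inf_le_inf_left _ (level_le hNN'))
  have hWM' : W' ≤ M' := le_of_gal_le (by rw [hWg', hMg']; exact inf_le_inf_right _ (gal_le h))
  have hFW' : F ≤ W' := hFW.trans hWW'
  have hM'n : F.NormalOver M' := hL.comp (normalOver_levelField F N')
  have hW'n : F.NormalOver W' := (normalOver_self F).comp (normalOver_levelField F N')
  have hWn : F.NormalOver W := hW ▸ (normalOver_self F).comp (normalOver_levelField F N)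
  have hun : M.gal ⊓ Z.inertia ≤ M'.gal := by
    rw [hMg, hMg']
    exact le_inf (inf_le_left.trans inf_le_left) (inf_le_right.trans (inertia_le_level _))
  have hunW : W.gal ⊓ Z.inertia ≤ W'.gal := by
    rw [hWg, hWg']
    exact le_inf (inf_le_left.trans inf_le_left) (inf_le_right.trans (inertia_le_level _))
  have hunF : F.gal ⊓ Z.inertia ≤ W'.gal := by
    rw [hWg']
    exact le_inf inf_le_left (inf_le_right.trans (inertia_le_level _))
  have hunFW : F.gal ⊓ Z.inertia ≤ W.gal := by
    rw [hWg]
    exact le_inf inf_le_left (inf_le_right.trans (inertia_le_level _))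
  have hdegW : degree hWW' = degree h := by
    have h1 := Z.degree_mul_resDeg hWW' hunW
    have h2 : Z.resDeg W' = N' :=
      resDeg_comp_levelField ((dvd_trans (dvd_mul_left _ _) hN).trans hNN')
    rw [hWN, h2] at h1
    exact Nat.eq_of_mul_eq_mul_right N.pos (h1.trans (mul_comm _ _))
  -- The power φ^n with n = N / f_F serves as Frobenius of M: it has degree N, and it fixes L
  -- because |L:F| divides n.
  have hψd : Z.deg ((φ ^ n : F.gal) : Gal(Ω/k)) = (N : ℕ) := by
    rw [Subgroup.coe_pow, deg_pow, hφ, hn]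
    simp
  have hψM : ((φ ^ n : F.gal) : Gal(Ω/k)) ∈ M.gal := by
    rw [hMg]
    refine ⟨?_, mem_level_of_natCast hψd dvd_rfl⟩
    refine pow_degree_mem h hL φ.2 ?_
    rw [hn] at hN
    exact Nat.dvd_of_mul_dvd_mul_right (Z.resDeg_pos F) hN
  have hgenF := exists_zpow_inv_mul_mem (F := F) (ν := Z.resDegP F) φ.2 hφ (gal_le_level F)
    (N := N') ((dvd_trans (dvd_mul_left _ _) hN).trans hNN')
  have hgenW := exists_zpow_inv_mul_mem (F := F) (ν := Z.resDegP F) φ.2 hφ (gal_le_level F)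
    (N := N) (dvd_trans (dvd_mul_left _ _) hN)
  rw [← hWg'] at hgenF
  rw [← hWg] at hgenW
  have hgenM := exists_zpow_inv_mul_mem (F := M) (ν := N) (N := N') hψM hψd
    (by rw [hMg]; exact inf_le_right) hNN'
  have hMM'g : M.gal ⊓ Z.level N' ≤ M'.gal := by
    rw [hMg, hMg']
    exact le_inf (inf_le_left.trans inf_le_left) inf_le_right
  obtain ⟨x', rfl, -⟩ := V.exists_norm_eq hA3 hMM' hun hx
  obtain ⟨v₁, rfl, -⟩ := V.exists_norm_eq hA3 hMM' hun hu₁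
  obtain ⟨v₂, rfl, -⟩ := V.exists_norm_eq hA3 hMM' hun hu₂
  -- The relation lifted to M' holds up to an element of norm 0 in A_M, which Hilbert 90 for M'/M
  -- writes as w - φ^n w.
  obtain ⟨w, hw⟩ := exists_sub_eq_of_A3 hA3 hMM' (hM'n.of_le (hFW.trans hWM)) hun
    ⟨((φ ^ n : F.gal) : Gal(Ω/k)), hψM⟩ (fun g hg => (hgenM g hg).imp fun j hj => hMM'g hj)
    (a := (A.rep hM'n φ x' - x') -
      ((A.rep hM'n τ₁ v₁ - v₁) + (A.rep hM'n τ₂ v₂ - v₂))) (by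
      simp only [map_sub, map_add, A.norm_rep hMn hM'n]
      rw [hrel, sub_self])
  replace hw : w - (A.rep hM'n φ ^ n) w = (A.rep hM'n φ x' - x') -
      ((A.rep hM'n τ₁ v₁ - v₁) + (A.rep hM'n τ₂ v₂ - v₂)) := by
    rw [← hw, ← map_pow]
    rfl
  -- Since (φ-1)s = φ^n w - w, adding s to x' removes the error.
  set s := ∑ j ∈ Finset.range n, (A.rep hM'n φ ^ j) w with hs
  -- The norm to W' kills (τᵢ-1)vᵢ, because inertial elements of G_F act trivially on A_{W'}.
  have hfix : A.rep hW'n φ (A.norm hWM' (x' + s)) = A.norm hWM' (x' + s) := by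
    have hτn : ∀ (τ : F.gal), (τ : Gal(Ω/k)) ∈ Z.inertia → ∀ b : A.obj M',
        A.norm hWM' (A.rep hM'n τ b) = A.norm hWM' b := by
      intro τ hτ b
      rw [A.norm_rep hW'n hM'n, A.rep_of_mem hW'n (hunF ⟨τ.2, hτ⟩)]
      rfl
    rw [← A.norm_rep hW'n hM'n, ← sub_eq_zero, ← map_sub]
    have : A.rep hM'n φ (x' + s) - (x' + s) =
        (A.rep hM'n τ₁ v₁ - v₁) + (A.rep hM'n τ₂ v₂ - v₂) := by
      have h1 := A.rep_sum_sub hM'n φ n w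
      rw [← hs] at h1
      rw [map_add]
      calc _ = (A.rep hM'n φ x' - x') + (A.rep hM'n φ s - s) := by abel
        _ = _ := by
          rw [h1, ← neg_sub w, hw]
          abel
    rw [this, map_add, map_sub, map_sub, hτn _ hτ₁, hτn _ hτ₂, sub_self, sub_self, add_zero]
  obtain ⟨b, hb⟩ := exists_res_eq_of_A3 hA3 hFW' hW'n hunF φ hgenF hfix
  have hpow : ∀ (j : ℕ) (b : A.obj M'), A.norm hMM' ((A.rep hM'n φ ^ j) b) =
      (A.rep hMn φ ^ j) (A.norm hMM' b) := by
    intro j b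
    rw [← map_pow, ← map_pow, A.norm_rep hMn hM'n]
  have hsum := A.res_norm_eq_sum (Z := Z) (hFW.trans hWM) hFW hWM le_rfl hMn (N := N) (ν := N)
    (n := n) hWg (by rw [hMg, inf_assoc, inf_idem]) φ hφ hψM hψd
    (by rw [hMg]; exact inf_le_right) hn dvd_rfl (A.norm hMM' w)
  -- Apply N_{W'/W} to `hb`; the double coset formula recognizes the contribution of s as the
  -- restriction of a norm from M.
  have hkey : A.res hFW (degree h • b) = A.res hFW (y + A.norm (hFW.trans hWM) (A.norm hMM' w)) := by
    have h1 := congrArg (A.norm hWW') hb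
    rw [A.norm_norm, ← A.res_res hFW hWW', A.norm_res, hdegW, ← map_nsmul,
      ← A.norm_norm hWM hMM', map_add, map_add, hxy, hs, map_sum] at h1
    rw [h1, map_add, hsum]
    simp only [hpow, A.res_self]
  have hinj := res_injective_of_A3 hA3 hFW hWn
    hunFW φ hgenW hkey
  rw [eq_comm, ← eq_sub_iff_add_eq, ← A.norm_res h, ← A.norm_norm h hLM] at hinj
  rw [hinj, ← map_sub]
  exact ⟨_, rfl⟩

end ClassValuation

/-! ### Frobenius lifts -/

namespace ZHatExtension

open FinExt

variable {k : Type u} {Ω : Type v} [Field k] [Field Ω] [Algebra k Ω]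
  {Z : ZHatExtension k Ω}

variable (Z) in
/-- `τ` fixes `F` and restricts to `Frob_F ^ n` on `F_pur`, with `n > 0`. -/
structure IsFrobLift (F : FinExt k Ω) (τ : Gal(Ω/k)) (n : ℕ) : Prop where
  mem : τ ∈ F.gal
  pos : 0 < n
  deg_eq : Z.deg τ = (n * Z.resDeg F : ℕ)

theorem isFrobLift_iff {F : FinExt k Ω} {τ : Gal(Ω/k)} {n : ℕ} :
    Z.IsFrobLift F τ n ↔ 0 < n ∧ Z.RestrictsToFrobPow F τ n :=
  ⟨fun h => ⟨h.pos, h.mem, (Z.deg_eq_nat_iff).1 h.deg_eq⟩,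
    fun h => ⟨h.2.1, h.1, (Z.deg_eq_nat_iff).2 h.2.2⟩⟩

variable {F L : FinExt k Ω}

theorem IsFrobLift.mul {σ τ : Gal(Ω/k)} {m n : ℕ} (hσ : Z.IsFrobLift F σ m)
    (hτ : Z.IsFrobLift F τ n) : Z.IsFrobLift F (σ * τ) (m + n) :=
  ⟨mul_mem hσ.mem hτ.mem, Nat.add_pos_left hσ.pos n, by
    rw [deg_mul, hσ.deg_eq, hτ.deg_eq, add_mul]; push_cast; rfl⟩

theorem IsFrobLift.conj {τ g : Gal(Ω/k)} {n : ℕ} (hτ : Z.IsFrobLift F τ n) (hg : g ∈ F.gal) :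
    Z.IsFrobLift F (g * τ * g⁻¹) n :=
  ⟨mul_mem (mul_mem hg hτ.mem) (inv_mem hg), hτ.pos, by rw [deg_conj, hτ.deg_eq]⟩

variable [IsGalois k Ω]

/-- The residue degree of the fixed field of a Frobenius lift. -/
noncomputable def IsFrobLift.nu {τ : Gal(Ω/k)} {n : ℕ} (hτ : Z.IsFrobLift F τ n) : ℕ+ :=
  ⟨n * Z.resDeg F, Nat.mul_pos hτ.pos (Z.resDeg_pos F)⟩

theorem conj_fixedIn (hL : F.NormalOver L) {g τ : Gal(Ω/k)} (hg : g ∈ F.gal) {S : FinExt k Ω}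
    (hS : S.1 = Z.fixedIn L τ) : (S.conj g).1 = Z.fixedIn L (g * τ * g⁻¹) := by
  have hpur : ∀ g ∈ F.gal, ∀ x ∈ Z.purOver L, g x ∈ Z.purOver L := by
    intro g hg x hx
    have h1 : (Z.purOver L).map (g : Ω →ₐ[k] Ω) ≤ Z.purOver L := by
      rw [purOver, IntermediateField.map_sup]
      have h2 : L.1.map (g : Ω →ₐ[k] Ω) = L.1 := (congrArg Subtype.val (hL g hg)).symm
      have := Z.galois
      rw [h2, (normal_iff_forall_map_eq' (K := Z.pur)).1 inferInstance g]
    exact h1 ⟨x, hx, rfl⟩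
  have hfix : ∀ (x : Ω) (σ : Gal(Ω/k)), x ∈ fixedField (Subgroup.zpowers σ) ↔ σ x = x := by
    intro x σ
    constructor
    · intro h
      exact h ⟨σ, Subgroup.mem_zpowers σ⟩
    · intro h
      have : Subgroup.zpowers σ ≤ MulAction.stabilizer Gal(Ω/k) x :=
        Subgroup.zpowers_le.2 h
      exact fun τ => this τ.2
  ext x
  change x ∈ S.1.map (g : Ω →ₐ[k] Ω) ↔ _
  rw [hS, IntermediateField.mem_map, fixedIn, fixedIn]
  simp only [IntermediateField.mem_inf, hfix]
  constructor
  · rintro ⟨y, ⟨hy, hτ⟩, rfl⟩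
    refine ⟨hpur g hg y hy, ?_⟩
    change g (τ (g.symm (g y))) = g y
    rw [AlgEquiv.symm_apply_apply, hτ]
  · rintro ⟨hx, hτ⟩
    refine ⟨g⁻¹ x, ⟨hpur _ (inv_mem hg) x hx, ?_⟩, AlgEquiv.apply_symm_apply g x⟩
    apply g.injective
    exact hτ.trans (AlgEquiv.apply_symm_apply g x).symm

end ZHatExtension

/-! ### Multiplicativity on Frobenius lifts -/

namespace ClassValuation

open FinExt ZHatExtension MackeyFunctor

variable {k : Type u} {Ω : Type v} [Field k] [Field Ω] [Algebra k Ω] [IsSepClosure k Ω]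
  {A : MackeyFunctor.{u, v, w} k Ω} {Z : ZHatExtension k Ω} (V : ClassValuation A Z)
  {F L M W : FinExt k Ω} (h : F ≤ L) (hL : F.NormalOver L)

include hL in
-- Take p to be the restriction of ϖ to M, which has valuation 1 because M/S is unramified, and X =
-- Σ_{j<n} φ^j p. The last relation is telescoping together with τ⁻¹p = p.
theorem exists_sum_rep (φ : F.gal) (hφ : Z.deg (φ : Gal(Ω/k)) = Z.resDeg F) {N : ℕ+}
    (hM : M = comp L (Z.levelField N)) (hW : W = comp F (Z.levelField N))
    (hMn : F.NormalOver M) (hFW : F ≤ W) (hWM : W ≤ M) {n : ℕ} {τ : F.gal}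
    (hτ : Z.IsFrobLift F (τ : Gal(Ω/k)) n) (hN : degree h * (n * Z.resDeg F) ∣ N)
    {S : FinExt k Ω} (hS : F ≤ S) (hSf : S.1 = Z.fixedIn L τ) {ϖ : A.obj S}
    (hϖ : V.IsPrimeElement S ϖ) :
    ∃ p X : A.obj M, A.norm hWM X = A.res hFW (A.norm hS ϖ) ∧ V.valOver M p = 1 ∧
      V.valOver M X = n ∧ A.rep hMn φ X - X = A.rep hMn (φ ^ n * τ⁻¹) p - p := by
  have hN' : degree h * hτ.nu ∣ N := hN
  have hMg : M.gal = L.gal ⊓ Z.level N := by rw [hM, gal_comp_levelField]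
  have hMS : M.gal = S.gal ⊓ Z.level N := by
    rw [hMg, gal_fixedIn_inf_level h hL hτ.mem hτ.deg_eq hN' hSf]
  have hSM : S ≤ M := le_of_gal_le (hMS ▸ inf_le_left)
  have hτS := mem_gal_of_fixedIn h hL hτ.mem (ν := hτ.nu) hτ.deg_eq hSf
  have hun : S.gal ⊓ Z.inertia ≤ M.gal := by
    rw [hMS]
    exact inf_le_inf_left _ (inertia_le_level N)
  have hSν : S.gal ≤ Z.level hτ.nu := by
    have h1 : Z.resDegP S = hτ.nu :=
      PNat.eq (resDeg_fixedIn h hL hτ.mem (ν := hτ.nu) hτ.deg_eq hSf)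
    exact h1 ▸ Z.gal_le_level S
  have hp : V.valOver M (A.res hSM ϖ) = 1 := (V.valOver_res hSM hun ϖ).trans hϖ
  refine ⟨A.res hSM ϖ, ∑ j ∈ Finset.range n, (A.rep hMn φ ^ j) (A.res hSM ϖ), ?_, hp, ?_, ?_⟩
  · exact (A.res_norm_eq_sum hS hFW hWM hSM hMn (by rw [hW, gal_comp_levelField]) hMS φ hφ hτS
      (ν := hτ.nu) hτ.deg_eq hSν rfl ((dvd_mul_left _ _).trans hN') ϖ).symm
  · rw [map_sum]
    simp only [← map_pow, V.valOver_rep, hp]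
    simp
  · rw [A.rep_sum_sub, map_mul, map_pow]
    have : A.rep hMn τ⁻¹ (A.res hSM ϖ) = A.res hSM ϖ := by
      have h1 : ((τ⁻¹ : F.gal) : Gal(Ω/k)) ∈ S.gal := S.gal.inv_mem hτS
      rw [rep_apply, A.conj_res _ hSM hSM (FinExt.conj_of_mem h1), A.conj_of_mem _ _ h1]
    change _ = (A.rep hMn φ ^ n) (A.rep hMn τ⁻¹ (A.res hSM ϖ)) - _
    rw [this]

variable (hA3 : AxiomA3 A Z)

include hA3 hL in
theorem norm_sub_norm_sub_norm_mem {σ₁ σ₂ : Gal(Ω/k)} {n₁ n₂ : ℕ} (h₁ : Z.IsFrobLift F σ₁ n₁)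
    (h₂ : Z.IsFrobLift F σ₂ n₂) {S₁ S₂ S₃ : FinExt k Ω} (hS₁ : F ≤ S₁) (hS₂ : F ≤ S₂)
    (hS₃ : F ≤ S₃) (hf₁ : S₁.1 = Z.fixedIn L σ₁) (hf₂ : S₂.1 = Z.fixedIn L σ₂)
    (hf₃ : S₃.1 = Z.fixedIn L (σ₁ * σ₂)) {ϖ₁ : A.obj S₁} {ϖ₂ : A.obj S₂} {ϖ₃ : A.obj S₃}
    (hϖ₁ : V.IsPrimeElement S₁ ϖ₁) (hϖ₂ : V.IsPrimeElement S₂ ϖ₂)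
    (hϖ₃ : V.IsPrimeElement S₃ ϖ₃) :
    A.norm hS₃ ϖ₃ - A.norm hS₁ ϖ₁ - A.norm hS₂ ϖ₂ ∈ A.normGroup h := by
  obtain ⟨φ₀, hφF, hφ⟩ := Z.exists_mem_gal_deg_eq_resDeg F
  let φ : F.gal := ⟨φ₀, hφF⟩
  let s₁ : F.gal := ⟨σ₁, h₁.mem⟩
  let s₂ : F.gal := ⟨σ₂, h₂.mem⟩
  -- Conjugating σ₂ by φ^n₁ leaves the norm of its prime element unchanged and makes the inertial
  -- parts multiply, see `hprod`.
  let g : F.gal := φ ^ n₁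
  have h₃ := h₁.mul h₂
  have h₄ : Z.IsFrobLift F ((g * s₂ * g⁻¹ : F.gal) : Gal(Ω/k)) n₂ := h₂.conj g.2
  have hf₄ : (S₂.conj g).1 = Z.fixedIn L ((g * s₂ * g⁻¹ : F.gal) : Gal(Ω/k)) :=
    conj_fixedIn hL g.2 hf₂
  have hgF := FinExt.conj_of_mem g.2
  have hS₄ : F ≤ S₂.conj g := hgF.le.trans (conj_mono _ hS₂)
  have hnorm₄ : A.norm hS₄ (A.conj g rfl ϖ₂) = A.norm hS₂ ϖ₂ := by
    rw [← A.conj_norm g hS₂ hS₄ hgF rfl, A.conj_of_mem _ _ g.2]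
  have hϖ₄ : V.IsPrimeElement (S₂.conj g) (A.conj g rfl ϖ₂) :=
    (V.valOver_conj _ _ _).trans hϖ₂
  let N : ℕ+ := ⟨degree h * (n₁ * Z.resDeg F) * (n₂ * Z.resDeg F) *
    ((n₁ + n₂) * Z.resDeg F), by
      have := degree_pos h
      have := Z.resDeg_pos F
      have := h₁.pos
      have := h₂.pos
      positivity⟩
  have hN : (N : ℕ) = degree h * (n₁ * Z.resDeg F) * (n₂ * Z.resDeg F) *
    ((n₁ + n₂) * Z.resDeg F) := rfl
  let M := comp L (Z.levelField N)
  let W := comp F (Z.levelField N)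
  have hMn : F.NormalOver M := hL.comp (normalOver_levelField F N)
  have hFW : F ≤ W := left_le_comp _ _
  have hWM : W ≤ M := sup_le_sup_right (show F.1 ≤ L.1 from h) _
  obtain ⟨p₁, X₁, hX₁, hp₁, hv₁, hr₁⟩ := V.exists_sum_rep h hL φ hφ rfl rfl hMn hFW hWM
    (τ := s₁) h₁ ⟨(n₂ * Z.resDeg F) * ((n₁ + n₂) * Z.resDeg F), by rw [hN]; ring⟩
    hS₁ hf₁ hϖ₁
  obtain ⟨p₂, X₂, hX₂, hp₂, hv₂, hr₂⟩ := V.exists_sum_rep h hL φ hφ rfl rfl hMn hFW hWM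
    (τ := g * s₂ * g⁻¹) h₄
    ⟨(n₁ * Z.resDeg F) * ((n₁ + n₂) * Z.resDeg F), by rw [hN]; ring⟩
    hS₄ hf₄ hϖ₄
  obtain ⟨p₃, X₃, hX₃, hp₃, hv₃, hr₃⟩ := V.exists_sum_rep h hL φ hφ rfl rfl hMn hFW hWM
    (τ := s₁ * s₂) h₃
    ⟨(n₁ * Z.resDeg F) * (n₂ * Z.resDeg F), by rw [hN]; ring⟩
    hS₃ hf₃ hϖ₃
  have hinert : ∀ {n : ℕ} {t : F.gal}, Z.IsFrobLift F (t : Gal(Ω/k)) n →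
      ((φ ^ n * t⁻¹ : F.gal) : Gal(Ω/k)) ∈ Z.inertia := by
    intro n t ht
    have h5 : Z.deg (φ : Gal(Ω/k)) = Z.resDeg F := hφ
    rw [← deg_eq_zero_iff, Subgroup.coe_mul, Subgroup.coe_pow, Subgroup.coe_inv, deg_mul, deg_pow,
      deg_inv, ht.deg_eq, h5]
    push_cast
    rw [nsmul_eq_mul, add_neg_cancel]
  have hprod : (φ ^ (n₁ + n₂) * (s₁ * s₂)⁻¹ : F.gal) =
      (φ ^ n₂ * (g * s₂ * g⁻¹)⁻¹) * (φ ^ n₁ * s₁⁻¹) := by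
    simp only [g, add_comm n₁ n₂, pow_add]
    group
  -- With a and b the two factors in `hprod`, u₁ and u₂ come from (ab-1)p₃ - (b-1)p₁ - (a-1)p₂ =
  -- (a-1)(bp₃-p₂) + (b-1)(p₃-p₁).
  refine V.mem_normGroup_of_relation hA3 h hL φ hφ (N := N) (M := M) (W := W)
    ⟨n₁ * (n₂ * Z.resDeg F) * ((n₁ + n₂) * Z.resDeg F), by rw [hN]; ring⟩ rfl rfl hMn hFW hWM (x := X₃ - X₁ - X₂)
    (u₁ := A.rep hMn (φ ^ n₁ * s₁⁻¹) p₃ - p₂) (u₂ := p₃ - p₁)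
    (hinert h₄) (hinert (t := s₁) h₁) ?_ ?_ ?_ ?_ ?_
  · rw [map_sub, map_sub, hX₁, hX₂, hX₃, map_sub, map_sub, hnorm₄]
  · rw [map_sub, map_sub, hv₁, hv₂, hv₃]
    push_cast
    ring
  · rw [map_sub, V.valOver_rep, hp₃, hp₂, sub_self]
  · rw [map_sub, hp₃, hp₁, sub_self]
  · rw [hprod, map_mul] at hr₃
    change _ = A.rep hMn _ (A.rep hMn _ p₃) - p₃ at hr₃
    simp only [map_sub]
    calc _ = (A.rep hMn φ X₃ - X₃) - (A.rep hMn φ X₁ - X₁) - (A.rep hMn φ X₂ - X₂) := by abel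
      _ = _ := by
        rw [hr₁, hr₂, hr₃]
        abel

end ClassValuation

namespace ZHatExtension

open FinExt

variable {k : Type u} {Ω : Type v} [Field k] [Field Ω] [Algebra k Ω] [IsGalois k Ω]
  {Z : ZHatExtension k Ω} {F L : FinExt k Ω}

theorem IsFrobLift.exists_fixedIn (h : F ≤ L) (hL : F.NormalOver L) {τ : Gal(Ω/k)} {n : ℕ}
    (hτ : Z.IsFrobLift F τ n) : ∃ S : FinExt k Ω, F ≤ S ∧ S.1 = Z.fixedIn L τ :=
  ZHatExtension.exists_fixedIn h hL hτ.mem (ν := hτ.nu) hτ.deg_eq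

/-- Approximate g by a positive power φ^n modulo f_L. The discrepancy in degree is the degree of
some l in G_L, and l⁻¹g is the lift. -/
theorem exists_isFrobLift (h : F ≤ L) (hL : F.NormalOver L) {g : Gal(Ω/k)} (hg : g ∈ F.gal) :
    ∃ τ n, Z.IsFrobLift F τ n ∧ g⁻¹ * τ ∈ L.gal := by
  obtain ⟨φ, hφF, hφ⟩ := Z.exists_mem_gal_deg_eq_resDeg F
  have hf := Z.resDeg_pos L
  obtain ⟨c, hc⟩ := exists_zpow_mul_mem_level (τ := φ) (ν := Z.resDegP F) hφ
    (gal_le_level F hg) (N := Z.resDegP F * Z.resDegP L) (by simp)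
  have hc := level_le (by simp : (Z.resDegP L : ℕ) ∣ (Z.resDegP F * Z.resDegP L : ℕ+)) hc
  -- A multiple of f_L makes the exponent positive without changing membership in level f_L.
  have hpos : 0 < c + (|c| + 1) * Z.resDeg L := by
    have h1 : (1 : ℤ) ≤ Z.resDeg L := by exact_mod_cast hf
    have h2 := neg_abs_le c
    nlinarith [abs_nonneg c]
  obtain ⟨n, hn⟩ := Int.eq_ofNat_of_zero_le hpos.le
  have hφn : φ ^ n = φ ^ (Z.resDeg L * (|c| + 1)) * φ ^ c := by
    rw [← zpow_natCast, ← zpow_add, ← hn]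
    congr 1
    ring
  have hmem : g * (φ ^ n)⁻¹ ∈ Z.level (Z.resDegP L) := by
    have h1 : (φ ^ (Z.resDeg L * (|c| + 1)))⁻¹ ∈ Z.level (Z.resDegP L) :=
      inv_mem ((zpow_mem_level_iff hφ).2 (by
        rw [coe_resDegP, mul_assoc]
        exact dvd_mul_right _ _))
    rw [hφn, mul_inv_rev, ← mul_assoc]
    exact mul_mem hc h1
  obtain ⟨l, hl, hd⟩ := exists_mem_gal_deg_eq hmem
  have hconj : g⁻¹ * (l⁻¹ * g) ∈ L.gal := by
    simpa [mul_assoc] using hL.conj_mem (inv_mem hg) (inv_mem hl)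
  have hlF : l⁻¹ * g ∈ F.gal := by
    exact F.gal.mul_mem (F.gal.inv_mem (gal_le h hl)) hg
  refine ⟨l⁻¹ * g, n, ⟨hlF, by omega, ?_⟩, hconj⟩
  rw [deg_mul, deg_inv, hd, deg_mul, deg_inv, deg_pow, hφ]
  push_cast
  rw [nsmul_eq_mul]
  ring

end ZHatExtension

/-! ### The reciprocity map and its functoriality -/

namespace ClassValuation

open FinExt ZHatExtension MackeyFunctor

variable {k : Type u} {Ω : Type v} [Field k] [Field Ω] [Algebra k Ω] [IsSepClosure k Ω]
  {A : MackeyFunctor.{u, v, w} k Ω} {Z : ZHatExtension k Ω} (V : ClassValuation A Z)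

open Classical in
/-- The class of the norm of a prime element of the fixed field of `τ` in `L_pur`. -/
noncomputable def frobNorm {F L : FinExt k Ω} (h : F ≤ L) (τ : Gal(Ω/k)) :
    A.obj F ⧸ A.normGroup h :=
  if hS : ∃ S : FinExt k Ω, F ≤ S ∧ S.1 = Z.fixedIn L τ then
    QuotientAddGroup.mk (A.norm hS.choose_spec.1 (V.exists_isPrimeElement hS.choose).choose)
  -- Default value, never reached for a Frobenius lift over F when L/F is normal.
  else 0

variable (hA3 : AxiomA3 A Z) {F L M : FinExt k Ω} (h : F ≤ L) (hL : F.NormalOver L)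

include hA3 hL in
-- Two prime elements of S differ by an element of valuation 0, which is a norm from the unramified
-- extension LS/S; its norm to F therefore factors through L.
theorem frobNorm_eq {τ : Gal(Ω/k)} {n : ℕ} (hτ : Z.IsFrobLift F τ n) {S : FinExt k Ω}
    (hS : F ≤ S) (hSf : S.1 = Z.fixedIn L τ) {ϖ : A.obj S} (hϖ : V.IsPrimeElement S ϖ) :
    V.frobNorm h τ = QuotientAddGroup.mk (A.norm hS ϖ) := by
  have key : ∀ (S' : FinExt k Ω) (hS' : F ≤ S') (ϖ' : A.obj S'), S'.1 = Z.fixedIn L τ →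
      V.IsPrimeElement S' ϖ' → (QuotientAddGroup.mk (A.norm hS' ϖ') : A.obj F ⧸ A.normGroup h) =
        QuotientAddGroup.mk (A.norm hS ϖ) := by
    intro S' hS' ϖ' hSf' hϖ'
    obtain rfl : S' = S := Subtype.ext (hSf'.trans hSf.symm)
    rw [eq_comm, QuotientAddGroup.eq, neg_add_eq_sub, ← map_sub]
    have hun : S'.gal ⊓ Z.inertia ≤ (comp L S').gal := by
      rw [gal_comp]
      exact le_inf (gal_fixedIn_inf_inertia h hL hτ.mem (ν := hτ.nu) hτ.deg_eq hSf) inf_le_left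
    obtain ⟨b, hb, -⟩ := V.exists_norm_eq hA3 (right_le_comp L S') hun (a := ϖ' - ϖ) (by
      rw [map_sub, hϖ, hϖ', sub_self])
    refine ⟨A.norm (left_le_comp L S') b, ?_⟩
    rw [← hb, A.norm_norm, A.norm_norm]
  have hex : ∃ S : FinExt k Ω, F ≤ S ∧ S.1 = Z.fixedIn L τ := ⟨S, hS, hSf⟩
  rw [frobNorm, dif_pos hex]
  exact key _ _ _ hex.choose_spec.2 (V.exists_isPrimeElement _).choose_spec

include hA3 hL in
theorem frobNorm_mul {σ τ : Gal(Ω/k)} {m n : ℕ} (hσ : Z.IsFrobLift F σ m)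
    (hτ : Z.IsFrobLift F τ n) :
    V.frobNorm h (σ * τ) = V.frobNorm h σ + V.frobNorm h τ := by
  obtain ⟨S₁, hS₁, hf₁⟩ := hσ.exists_fixedIn h hL
  obtain ⟨S₂, hS₂, hf₂⟩ := hτ.exists_fixedIn h hL
  obtain ⟨S₃, hS₃, hf₃⟩ := (hσ.mul hτ).exists_fixedIn h hL
  obtain ⟨ϖ₁, h₁⟩ := V.exists_isPrimeElement S₁
  obtain ⟨ϖ₂, h₂⟩ := V.exists_isPrimeElement S₂
  obtain ⟨ϖ₃, h₃⟩ := V.exists_isPrimeElement S₃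
  rw [V.frobNorm_eq hA3 h hL hσ hS₁ hf₁ h₁, V.frobNorm_eq hA3 h hL hτ hS₂ hf₂ h₂,
    V.frobNorm_eq hA3 h hL (hσ.mul hτ) hS₃ hf₃ h₃, ← QuotientAddGroup.mk_add, eq_comm,
    QuotientAddGroup.eq, neg_add_eq_sub, ← sub_sub]
  exact V.norm_sub_norm_sub_norm_mem h hL hA3 hσ hτ hS₁ hS₂ hS₃ hf₁ hf₂ hf₃ h₁ h₂ h₃

include hA3 hL in
-- If τ fixes L, then L is contained in its fixed field, and the norm passes through A_L.
theorem frobNorm_of_mem {τ : Gal(Ω/k)} {n : ℕ} (hτ : Z.IsFrobLift F τ n) (hτL : τ ∈ L.gal) :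
    V.frobNorm h τ = 0 := by
  obtain ⟨S, hS, hf⟩ := hτ.exists_fixedIn h hL
  obtain ⟨ϖ, hϖ⟩ := V.exists_isPrimeElement S
  rw [V.frobNorm_eq hA3 h hL hτ hS hf hϖ, QuotientAddGroup.eq_zero_iff]
  have hLS : L.1 ≤ S.1 := by
    rw [hf]
    refine le_inf (le_sup_left : L.1 ≤ L.1 ⊔ Z.pur) ?_
    rw [IntermediateField.le_iff_le]
    exact Subgroup.zpowers_le.2 hτL
  exact ⟨A.norm hLS ϖ, A.norm_norm h hLS ϖ⟩

include hA3 hL in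
-- With d = |L:F|, write σ·τ^d = τ·(τ⁻¹στ^d). Both τ^d and τ⁻¹στ^d are Frobenius lifts in G_L, so
-- they have trivial class and multiplicativity gives the claim.
theorem frobNorm_congr {σ τ : Gal(Ω/k)} {m n : ℕ} (hσ : Z.IsFrobLift F σ m)
    (hτ : Z.IsFrobLift F τ n) (hστ : τ⁻¹ * σ ∈ L.gal) : V.frobNorm h σ = V.frobNorm h τ := by
  have he := degree_pos h
  have hρL : τ ^ degree h ∈ L.gal := pow_degree_mem h hL hτ.mem dvd_rfl
  have hρ : Z.IsFrobLift F (τ ^ degree h) (degree h * n) :=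
    ⟨pow_mem hτ.mem _, Nat.mul_pos he hτ.pos, by
      rw [deg_pow, hτ.deg_eq]; push_cast; rw [nsmul_eq_mul]; ring⟩
  have hle : n ≤ degree h * n := Nat.le_mul_of_pos_left n he
  have hρ' : Z.IsFrobLift F (τ⁻¹ * σ * τ ^ degree h) (m + (degree h * n - n)) :=
    ⟨mul_mem (mul_mem (inv_mem hτ.mem) hσ.mem) hρ.mem, Nat.add_pos_left hσ.pos _, by
      rw [deg_mul, deg_mul, deg_inv, hτ.deg_eq, hσ.deg_eq, hρ.deg_eq]
      obtain ⟨d, hd⟩ := Nat.exists_eq_add_of_le hle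
      rw [hd]
      push_cast
      rw [Nat.add_sub_cancel_left]
      ring⟩
  have h1 := V.frobNorm_mul hA3 h hL hσ hρ
  have h2 := V.frobNorm_mul hA3 h hL hτ hρ'
  rw [V.frobNorm_of_mem hA3 h hL hρ hρL, add_zero] at h1
  rw [V.frobNorm_of_mem hA3 h hL hρ' (mul_mem hστ hρL), add_zero] at h2
  rw [← h1, ← h2]
  congr 1
  group

/-- The reciprocity map, as a homomorphism on the absolute Galois group of `F`. -/
noncomputable def recHom : F.gal →* Multiplicative (A.obj F ⧸ A.normGroup h) :=
  have hmain : ∀ {g τ : Gal(Ω/k)} {n : ℕ} (hg : g ∈ F.gal), Z.IsFrobLift F τ n →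
      g⁻¹ * τ ∈ L.gal →
      V.frobNorm h (exists_isFrobLift (Z := Z) h hL hg).choose = V.frobNorm h τ := by
    intro g τ n hg hτ hgτ
    obtain ⟨n', hn', hg'⟩ := (exists_isFrobLift (Z := Z) h hL hg).choose_spec
    refine V.frobNorm_congr hA3 h hL hn' hτ ?_
    have := mul_mem (inv_mem hgτ) hg'
    simpa [mul_assoc] using this
  MonoidHom.mk' (fun g => Multiplicative.ofAdd
    (V.frobNorm h (exists_isFrobLift (Z := Z) h hL g.2).choose)) (by
    intro a b
    obtain ⟨m, hm, ha⟩ := (exists_isFrobLift (Z := Z) h hL a.2).choose_spec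
    obtain ⟨n, hn, hb⟩ := (exists_isFrobLift (Z := Z) h hL b.2).choose_spec
    rw [← ofAdd_add, ← V.frobNorm_mul hA3 h hL hm hn, hmain (a * b).2 (hm.mul hn)]
    have h1 := hL.conj_mem (inv_mem b.2) ha
    have h2 := mul_mem h1 hb
    simpa [mul_assoc] using h2)

theorem recHom_eq {g : F.gal} {τ : Gal(Ω/k)} {n : ℕ} (hτ : Z.IsFrobLift F τ n)
    (hgτ : (g : Gal(Ω/k))⁻¹ * τ ∈ L.gal) :
    V.recHom hA3 h hL g = Multiplicative.ofAdd (V.frobNorm h τ) := by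
  obtain ⟨n', hn', hg'⟩ := (exists_isFrobLift (Z := Z) h hL g.2).choose_spec
  refine congrArg Multiplicative.ofAdd (V.frobNorm_congr hA3 h hL hn' hτ ?_)
  have := mul_mem (inv_mem hgτ) hg'
  simpa [mul_assoc] using this

theorem recHom_of_mem {g : F.gal} (hg : (g : Gal(Ω/k)) ∈ L.gal) : V.recHom hA3 h hL g = 1 := by
  obtain ⟨τ, n, hτ, hgτ⟩ := exists_isFrobLift (Z := Z) h hL g.2
  rw [V.recHom_eq hA3 h hL hτ hgτ, V.frobNorm_of_mem hA3 h hL hτ (by simpa using mul_mem hg hgτ)]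
  rfl

/-- Compatibility of the reciprocity map with passing to a subextension. -/
theorem recHom_of_le (hFM : F ≤ M) (hML : M ≤ L) (hM : F.NormalOver M) (g : F.gal) :
    ∃ a : A.obj F, V.recHom hA3 h hL g = Multiplicative.ofAdd (a : A.obj F ⧸ A.normGroup h) ∧
      V.recHom hA3 hFM hM g = Multiplicative.ofAdd (a : A.obj F ⧸ A.normGroup hFM) := by
  obtain ⟨τ, n, hτ, hgτ⟩ := exists_isFrobLift (Z := Z) h hL g.2
  obtain ⟨S, hS, hf⟩ := hτ.exists_fixedIn h hL
  obtain ⟨T, hT, hfT⟩ := hτ.exists_fixedIn hFM hM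
  obtain ⟨ϖ, hϖ⟩ := V.exists_isPrimeElement S
  have hTS : T ≤ S := by
    change T.1 ≤ S.1
    rw [hf, hfT]
    exact inf_le_inf_right _ (sup_le_sup_right (show M.1 ≤ L.1 from hML) _)
  refine ⟨A.norm hS ϖ, ?_, ?_⟩
  · rw [V.recHom_eq hA3 h hL hτ hgτ, V.frobNorm_eq hA3 h hL hτ hS hf hϖ]
  · rw [V.recHom_eq hA3 hFM hM hτ (gal_le hML hgτ), ← A.norm_norm hT hTS,
      V.frobNorm_eq hA3 hFM hM hτ hT hfT]
    -- S and T have the same residue degree, so the norm of a prime element of S is a prime element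
    -- of T.
    have h1 := V.resDeg_mul_valOver_norm hTS ϖ
    have h2 : Z.resDeg S = Z.resDeg T :=
      (resDeg_fixedIn h hL hτ.mem (ν := hτ.nu) hτ.deg_eq hf).trans
        (resDeg_fixedIn hFM hM hτ.mem (ν := hτ.nu) hτ.deg_eq hfT).symm
    rw [h2, hϖ] at h1
    exact mul_left_cancel₀ (resDeg_ne_zero T) h1

/-- Compatibility of the reciprocity map with the norm. -/
theorem recHom_norm (hFM : F ≤ M) (hML : M ≤ L) (g : M.gal) :
    ∃ a : A.obj M, V.recHom hA3 hML (hL.of_le hFM) g =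
        Multiplicative.ofAdd (a : A.obj M ⧸ A.normGroup hML) ∧
      V.recHom hA3 h hL ⟨g, gal_le hFM g.2⟩ =
        Multiplicative.ofAdd (A.norm hFM a : A.obj F ⧸ A.normGroup h) := by
  obtain ⟨τ, n, hτ, hgτ⟩ := exists_isFrobLift (Z := Z) hML (hL.of_le hFM) g.2
  obtain ⟨S, hS, hf⟩ := hτ.exists_fixedIn hML (hL.of_le hFM)
  obtain ⟨ϖ, hϖ⟩ := V.exists_isPrimeElement S
  -- The same τ and the same fixed field serve over F; only the exponent is multiplied by f_M / f_F.
  obtain ⟨c, hc⟩ := Z.resDeg_dvd hFM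
  have hτF : Z.IsFrobLift F τ (n * c) := by
    refine ⟨gal_le hFM hτ.mem, Nat.mul_pos hτ.pos (Nat.pos_of_ne_zero ?_), ?_⟩
    · rintro rfl
      exact (Z.resDeg_pos M).ne' hc
    · rw [hτ.deg_eq, hc, mul_assoc, mul_comm c]
  refine ⟨A.norm hS ϖ, ?_, ?_⟩
  · rw [V.recHom_eq hA3 hML (hL.of_le hFM) hτ hgτ, V.frobNorm_eq hA3 hML (hL.of_le hFM) hτ hS hf hϖ]
  · rw [V.recHom_eq hA3 h hL (g := ⟨g, gal_le hFM g.2⟩) hτF hgτ, A.norm_norm,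
      V.frobNorm_eq hA3 h hL hτF (hFM.trans hS) hf hϖ]

/-- Compatibility of the reciprocity map with conjugation. -/
theorem recHom_conj (hFM : F ≤ M) (hML : M ≤ L) (hM : F.NormalOver M) (s : F.gal) (g : M.gal)
    {g' : M.gal} (hg' : (g' : Gal(Ω/k)) = s * g * (s : Gal(Ω/k))⁻¹) :
    ∃ a : A.obj M, V.recHom hA3 hML (hL.of_le hFM) g =
        Multiplicative.ofAdd (a : A.obj M ⧸ A.normGroup hML) ∧
      V.recHom hA3 hML (hL.of_le hFM) g' =
        Multiplicative.ofAdd (A.rep hM s a : A.obj M ⧸ A.normGroup hML) := by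
  obtain ⟨τ, n, hτ, hgτ⟩ := exists_isFrobLift (Z := Z) hML (hL.of_le hFM) g.2
  obtain ⟨S, hS, hf⟩ := hτ.exists_fixedIn hML (hL.of_le hFM)
  obtain ⟨ϖ, hϖ⟩ := V.exists_isPrimeElement S
  have hτ' : Z.IsFrobLift M (s * τ * (s : Gal(Ω/k))⁻¹) n :=
    ⟨hM.conj_mem s.2 hτ.mem, hτ.pos, by rw [deg_conj, hτ.deg_eq]⟩
  have hS' : M ≤ S.conj s := (hM s s.2).le.trans (conj_mono _ hS)
  refine ⟨A.norm hS ϖ, ?_, ?_⟩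
  · rw [V.recHom_eq hA3 hML (hL.of_le hFM) hτ hgτ, V.frobNorm_eq hA3 hML (hL.of_le hFM) hτ hS hf hϖ]
  · rw [V.recHom_eq hA3 hML (hL.of_le hFM) hτ', rep_apply, A.conj_norm _ hS hS' _ rfl,
      V.frobNorm_eq hA3 hML (hL.of_le hFM) hτ' hS' (conj_fixedIn hL s.2 hf)]
    · exact (V.valOver_conj _ _ _).trans hϖ
    · rw [hg']
      simpa [mul_assoc] using hL.conj_mem s.2 hgτ

end ClassValuation

/-! ### Finite groups and intermediate fields -/

/-- The quotient by a maximal proper subgroup is simple and abelian, hence of prime order. -/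
theorem Subgroup.exists_normal_index_prime_of_comm {G : Type*} [Group G] [Finite G] [Nontrivial G]
    (hc : ∀ a b : G, a * b = b * a) : ∃ Q : Subgroup G, Q.Normal ∧ Q.index.Prime := by
  let _ : CommGroup G := { ‹Group G› with mul_comm := hc }
  obtain h0 | ⟨Q, hQ, -⟩ := eq_top_or_exists_le_coatom (⊥ : Subgroup G)
  · exact absurd h0 bot_ne_top
  refine ⟨Q, inferInstance, ?_⟩
  have hs : IsSimpleGroup (G ⧸ Q) := by
    have : Nontrivial (G ⧸ Q) := QuotientGroup.nontrivial_iff.2 hQ.1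
    refine ⟨fun K _ => ?_⟩
    have hinj := Subgroup.comap_injective (QuotientGroup.mk'_surjective Q)
    have hle : Q ≤ K.comap (QuotientGroup.mk' Q) := by
      intro x hx
      have : QuotientGroup.mk' Q x = 1 := (QuotientGroup.eq_one_iff x).2 hx
      rw [Subgroup.mem_comap, this]
      exact one_mem K
    rcases hle.eq_or_lt with h1 | h1
    · left
      apply hinj
      rw [← h1, MonoidHom.comap_bot, QuotientGroup.ker_mk']
    · right
      apply hinj
      rw [hQ.2 _ h1, Subgroup.comap_top]
  exact CommGroup.is_simple_iff_prime_card.1 hs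

theorem Subgroup.eq_of_le_of_index_eq {G : Type*} [Group G] {H K : Subgroup G} (h : H ≤ K)
    (hi : H.index = K.index) (h0 : K.index ≠ 0) : H = K := by
  refine le_antisymm h ?_
  rw [← Subgroup.relIndex_eq_one]
  have := Subgroup.relIndex_mul_index h
  rw [hi] at this
  exact Nat.eq_of_mul_eq_mul_right (Nat.pos_of_ne_zero h0) (this.trans (one_mul _).symm)

namespace FinExt

variable {k : Type u} {Ω : Type v} [Field k] [Field Ω] [Algebra k Ω] [IsSepClosure k Ω]
  {F L : FinExt k Ω} (h : F ≤ L) (hL : F.NormalOver L)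

include hL in
theorem card_galGroup : Nat.card (GalGroup h) = degree h := by
  have := isGalois_of_normalOver h hL
  have : FiniteDimensional F.1 (relExt h) := by
    apply Module.finite_of_finrank_pos
    exact degree_pos h
  exact IsGalois.card_aut_eq_finrank F.1 (relExt h)

include hL in
theorem finite_galGroup : Finite (GalGroup h) :=
  Nat.finite_of_card_ne_zero (by rw [card_galGroup h hL]; exact (degree_pos h).ne')

theorem exists_finExt_of_subgroup (Q : Subgroup (GalGroup h)) :
    ∃ (M : FinExt k Ω) (hFM : F ≤ M) (hML : M ≤ L),
      (∀ g : F.gal, (g : Gal(Ω/k)) ∈ M.gal ↔ resHom h hL g ∈ Q) ∧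
      degree hFM = Q.index ∧ degree hML = Nat.card Q ∧ (Q.Normal → F.NormalOver M) := by
  let H : Subgroup Gal(Ω/k) := (Q.comap (resHom h hL)).map F.gal.subtype
  have hmem : ∀ g : F.gal, (g : Gal(Ω/k)) ∈ H ↔ resHom h hL g ∈ Q := by
    intro g
    constructor
    · rintro ⟨g', hg', he⟩
      obtain rfl : g' = g := Subtype.ext he
      exact hg'
    · intro hg
      exact ⟨g, hg, rfl⟩
  have hLH : L.gal ≤ H := by
    intro g hg
    refine (hmem ⟨g, gal_le h hg⟩).2 ?_
    have : (⟨g, gal_le h hg⟩ : F.gal) ∈ (resHom h hL).ker := by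
      rw [ker_resHom]; exact hg
    rw [MonoidHom.mem_ker] at this
    rw [this]
    exact one_mem Q
  have hHF : H ≤ F.gal := by
    rintro _ ⟨g, -, rfl⟩
    exact g.2
  have hopen : IsOpen (H : Set Gal(Ω/k)) := Subgroup.isOpen_mono hLH L.gal_isOpen
  have hg : (ofOpen H hopen).gal = H := gal_ofOpen H hopen
  have hFM : F ≤ ofOpen H hopen := le_of_gal_le (by rwa [hg])
  have hML : ofOpen H hopen ≤ L := le_of_gal_le (by rwa [hg])
  have hdeg : degree hFM = Q.index := by
    have : H.subgroupOf F.gal = Q.comap (resHom h hL) := by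
      ext g
      rw [Subgroup.mem_subgroupOf, hmem, Subgroup.mem_comap]
    rw [degree_eq_relIndex, hg, Subgroup.relIndex, this,
      Subgroup.index_comap_of_surjective _ (resHom_surjective h hL)]
  refine ⟨ofOpen H hopen, hFM, hML, by rwa [hg], hdeg, ?_, ?_⟩
  · have h1 := degree_mul_degree hFM hML
    rw [hdeg, ← card_galGroup (hFM.trans hML) hL, ← Q.card_mul_index, mul_comm] at h1
    refine Nat.eq_of_mul_eq_mul_right (Nat.pos_of_ne_zero ?_) h1
    rw [← hdeg]
    exact (degree_pos hFM).ne'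
  · intro hQ
    rw [normalOver_iff, hg]
    intro g hgF x hx
    have hxF := hHF hx
    have h2 := hQ.conj_mem _ ((hmem ⟨x, hxF⟩).1 hx) (resHom h hL ⟨g, hgF⟩)
    rw [← map_mul, ← map_inv, ← map_mul] at h2
    exact (hmem _).2 h2

end FinExt

/-! ### Extensions of prime degree -/

namespace ClassValuation

open FinExt ZHatExtension MackeyFunctor

variable {k : Type u} {Ω : Type v} [Field k] [Field Ω] [Algebra k Ω] [IsSepClosure k Ω]
  {A : MackeyFunctor.{u, v, w} k Ω} {Z : ZHatExtension k Ω} (V : ClassValuation A Z)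
  (hA3 : AxiomA3 A Z) {F L M : FinExt k Ω} (h : F ≤ L) (hL : F.NormalOver L)

/-- Prime degree, `L` inside `F_pur`. -/
theorem exists_recHom_ne_one_of_le_pur (hp : (degree h).Prime)
    (hun : F.gal ⊓ Z.inertia ≤ L.gal) : ∃ g, V.recHom hA3 h hL g ≠ 1 := by
  obtain ⟨φ, hφF, hφ⟩ := Z.exists_mem_gal_deg_eq_resDeg F
  have hfr : Z.IsFrobLift F φ 1 := ⟨hφF, one_pos, by rw [one_mul, hφ]⟩
  obtain ⟨S, hS, hf⟩ := hfr.exists_fixedIn h hL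
  obtain ⟨ϖ, hϖ⟩ := V.exists_isPrimeElement S
  refine ⟨⟨φ, hφF⟩, fun h1 => ?_⟩
  rw [V.recHom_eq hA3 h hL hfr (by simp), V.frobNorm_eq hA3 h hL hfr hS hf hϖ,
    ← ofAdd_zero, Multiplicative.ofAdd.injective.eq_iff, QuotientAddGroup.eq_zero_iff] at h1
  obtain ⟨b, hb⟩ := h1
  have hb : A.norm h b = A.norm hS ϖ := hb
  -- The norm of ϖ has valuation 1 because S and F have equal residue degree, while norms from L
  -- have valuation divisible by |L:F|.
  have h2 := V.resDeg_mul_valOver_norm hS ϖ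
  have h3 : Z.resDeg S = 1 * Z.resDeg F :=
    resDeg_fixedIn h hL hfr.mem (ν := hfr.nu) hfr.deg_eq hf
  rw [← hb, V.resDeg_mul_valOver_norm, hϖ, h3, ← Z.degree_mul_resDeg h hun] at h2
  push_cast at h2
  have h4 : (degree h : ℤ) * V.valOver L b = 1 := by
    refine mul_left_cancel₀ (resDeg_ne_zero (Z := Z) F) ?_
    linarith
  have h5 : (degree h : ℤ) ∣ 1 := Dvd.intro _ h4
  exact hp.one_lt.ne' (by exact_mod_cast Int.eq_one_of_dvd_one (by positivity) h5)

include hL in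
theorem commutator_mem_of_prime (hp : (degree h).Prime) {a b : Gal(Ω/k)} (ha : a ∈ F.gal)
    (hb : b ∈ F.gal) : a * b * a⁻¹ * b⁻¹ ∈ L.gal := by
  have : Fact (degree h).Prime := ⟨hp⟩
  have hcyc : IsCyclic (GalGroup h) := isCyclic_of_prime_card (card_galGroup h hL)
  have hcomm : ∀ x y : GalGroup h, x * y = y * x :=
    fun x y => hcyc.isMulCommutative.is_comm.comm x y
  have h1 : (⟨a, ha⟩ * ⟨b, hb⟩ * ⟨a, ha⟩⁻¹ * ⟨b, hb⟩⁻¹ : F.gal) ∈ (resHom h hL).ker := by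
    rw [MonoidHom.mem_ker]
    simp only [map_mul, map_inv]
    rw [hcomm (resHom h hL ⟨a, ha⟩)]
    simp
  rw [ker_resHom] at h1
  exact h1

include hL in
theorem exists_zpow_of_prime (hp : (degree h).Prime) {σ g : Gal(Ω/k)} (hσ : σ ∈ F.gal)
    (hσL : σ ∉ L.gal) (hg : g ∈ F.gal) : ∃ j : ℤ, (σ ^ j)⁻¹ * g ∈ L.gal := by
  have : Fact (degree h).Prime := ⟨hp⟩
  have h1 : resHom h hL ⟨σ, hσ⟩ ≠ 1 := by
    intro h1
    have h2 : (⟨σ, hσ⟩ : F.gal) ∈ (resHom h hL).ker := h1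
    rw [ker_resHom] at h2
    exact hσL h2
  have h2 := mem_zpowers_of_prime_card (card_galGroup h hL) h1 (g' := resHom h hL ⟨g, hg⟩)
  obtain ⟨j, hj⟩ := h2
  refine ⟨j, ?_⟩
  have hj : resHom h hL ⟨σ, hσ⟩ ^ j = resHom h hL ⟨g, hg⟩ := hj
  rw [← map_zpow, eq_comm, resHom_eq_iff] at hj
  exact hj

/-- Prime degree, `L` not inside `F_pur`. -/
theorem exists_recHom_ne_one_of_not_le_pur (hA4 : AxiomA4 A) (hp : (degree h).Prime)
    (hun : ¬ F.gal ⊓ Z.inertia ≤ L.gal) : ∃ g, V.recHom hA3 h hL g ≠ 1 := by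
  obtain ⟨σ, ⟨hσF, hσP⟩, hσL⟩ := SetLike.not_le_iff_exists.1 hun
  by_contra! htriv
  obtain ⟨φ', hφF', hφ'⟩ := Z.exists_mem_gal_deg_eq_resDeg F
  -- A power of the inertial σ corrects the Frobenius so that φ fixes L, whereas σφ does not.
  obtain ⟨j, hφL⟩ := exists_zpow_of_prime h hL hp hσF hσL hφF'
  set φ := (σ ^ j)⁻¹ * φ'
  have hσd : Z.deg σ = 0 := (Z.deg_eq_zero_iff).2 hσP
  have hφ : Z.deg φ = Z.resDeg F := by
    rw [deg_mul, deg_inv, deg_zpow, hσd, hφ']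
    simp
  have hτ : Z.IsFrobLift F (σ * φ) 1 :=
    ⟨mul_mem hσF (gal_le h hφL), one_pos, by rw [deg_mul, hσd, hφ, zero_add, one_mul]⟩
  obtain ⟨S, hS, hf⟩ := hτ.exists_fixedIn h hL
  have hfS : Z.resDeg S = Z.resDeg F :=
    (resDeg_fixedIn h hL hτ.mem (ν := hτ.nu) hτ.deg_eq hf).trans (one_mul _)
  have hfL : Z.resDeg L = Z.resDeg F := by
    refine Nat.dvd_antisymm ?_ (Z.resDeg_dvd h)
    have := gal_le_level (Z := Z) L hφL
    rw [mem_level, hφ] at this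
    exact (ZMod.natCast_eq_zero_iff _ _).1 this
  let N : ℕ+ := ⟨degree h * (1 * Z.resDeg F),
    Nat.mul_pos (degree_pos h) (Nat.mul_pos one_pos (Z.resDeg_pos F))⟩
  have hN : degree h * hτ.nu ∣ N := dvd_rfl
  have hinf := gal_fixedIn_inf_level h hL hτ.mem (ν := hτ.nu) hτ.deg_eq hN hf
  -- Conjugation changes x by a commutator, which is inertial and lies in G_L because Gal(L/F) is
  -- abelian, hence lies in G_S.
  have hSn : F.NormalOver S := by
    rw [normalOver_iff]
    intro g hg x hx
    have h1 : g * x * g⁻¹ * x⁻¹ ∈ S.gal ⊓ Z.level N := by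
      rw [hinf]
      refine ⟨commutator_mem_of_prime h hL hp hg (gal_le hS hx), inertia_le_level N ?_⟩
      rw [← deg_eq_zero_iff, deg_mul, deg_conj, deg_inv, add_neg_cancel]
    simpa using mul_mem h1.1 hx
  -- Both fields have the residue degree of F and the same compositum with k_N.
  have hdeg : degree hS = degree h := by
    have hLM : L ≤ comp L (Z.levelField N) := left_le_comp _ _
    have hSM : S ≤ comp L (Z.levelField N) :=
      le_of_gal_le (by rw [gal_comp_levelField, ← hinf]; exact inf_le_left)
    have h1 := Z.degree_mul_resDeg hLM
      (by rw [gal_comp_levelField]; exact inf_le_inf_left _ (inertia_le_level N))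
    have h2 := Z.degree_mul_resDeg hSM
      (by rw [gal_comp_levelField, ← hinf]; exact inf_le_inf_left _ (inertia_le_level N))
    rw [hfL] at h1
    rw [hfS, ← h1] at h2
    have h3 := Nat.eq_of_mul_eq_mul_right (Z.resDeg_pos F) h2
    have h4 := (degree_mul_degree hS hSM).trans (degree_mul_degree h hLM).symm
    rw [h3] at h4
    exact Nat.eq_of_mul_eq_mul_right (degree_pos hLM) h4
  have hprime : ∀ ϖ, V.IsPrimeElement S ϖ → A.norm hS ϖ ∈ A.normGroup h := by
    intro ϖ hϖ
    have h1 := htriv ⟨σ * φ, hτ.mem⟩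
    rwa [V.recHom_eq hA3 h hL hτ (by simp), V.frobNorm_eq hA3 h hL hτ hS hf hϖ,
      ← ofAdd_zero, Multiplicative.ofAdd.injective.eq_iff, QuotientAddGroup.eq_zero_iff] at h1
  have hle : A.normGroup hS ≤ A.normGroup h := by
    rintro _ ⟨c, rfl⟩
    obtain ⟨ϖ, hϖ⟩ := V.exists_isPrimeElement S
    -- Prime elements generate A_S: c is this prime element plus a multiple of ϖ.
    have h1 : V.IsPrimeElement S (c - (V.valOver S c - 1) • ϖ) := by
      have hϖ' : V.valOver S ϖ = 1 := hϖ
      rw [IsPrimeElement, map_sub, map_zsmul, hϖ']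
      simp
    have h2 := (A.normGroup h).add_mem (hprime _ h1)
      ((A.normGroup h).zsmul_mem (hprime _ hϖ) (V.valOver S c - 1))
    rw [← map_zsmul, ← map_add, sub_add_cancel] at h2
    exact h2
  have hi := (hA4 F L h (isGalois_of_normalOver h hL) hp).2.1
  have hi' := (hA4 F S hS (isGalois_of_normalOver hS hSn) (by rwa [hdeg])).2.1
  have heq : A.normGroup hS = A.normGroup h := by
    refine le_antisymm hle ?_
    rw [← AddSubgroup.relIndex_eq_one]
    have := AddSubgroup.relIndex_mul_index hle
    rw [hi, hi', hdeg] at this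
    exact Nat.eq_of_mul_eq_mul_right (degree_pos h) (this.trans (one_mul _).symm)
  have hLS := (hA4 F L h (isGalois_of_normalOver h hL) hp).2.2 S hS
    (isGalois_of_normalOver hS hSn) hdeg heq
  subst hLS
  have hτL := mem_gal_of_fixedIn h hL hτ.mem (ν := hτ.nu) hτ.deg_eq hf
  exact hσL (by simpa using mul_mem hτL (inv_mem hφL))

/-- The kernel contains G_L, of prime index in G_F, so a nontrivial map has kernel G_L. Counting
with (A4)(b) gives surjectivity. -/
theorem recHom_of_prime (hA4 : AxiomA4 A) (hp : (degree h).Prime) :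
    (∀ g, V.recHom hA3 h hL g = 1 → (g : Gal(Ω/k)) ∈ L.gal) ∧
      Function.Surjective (V.recHom hA3 h hL) := by
  have hne : ∃ g, V.recHom hA3 h hL g ≠ 1 := by
    by_cases hun : F.gal ⊓ Z.inertia ≤ L.gal
    · exact V.exists_recHom_ne_one_of_le_pur hA3 h hL hp hun
    · exact V.exists_recHom_ne_one_of_not_le_pur hA3 h hL hA4 hp hun
  have hle : L.gal.subgroupOf F.gal ≤ (V.recHom hA3 h hL).ker :=
    fun g hg => V.recHom_of_mem hA3 h hL hg
  have hKi : (L.gal.subgroupOf F.gal).index = degree h := (degree_eq_relIndex h).symm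
  have hki : (V.recHom hA3 h hL).ker.index = degree h := by
    have h1 := Subgroup.index_dvd_of_le hle
    rw [hKi, Nat.dvd_prime hp, Subgroup.index_eq_one] at h1
    refine h1.resolve_left fun h2 => ?_
    obtain ⟨g, hg⟩ := hne
    exact hg (MonoidHom.mem_ker.1 (h2 ▸ Subgroup.mem_top g))
  constructor
  · intro g hg
    have := Subgroup.eq_of_le_of_index_eq hle (hKi.trans hki.symm) (by rw [hki]; exact hp.ne_zero)
    have h2 : g ∈ (V.recHom hA3 h hL).ker := hg
    rw [← this] at h2
    exact h2
  · rw [← MonoidHom.range_eq_top]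
    have hi := (hA4 F L h (isGalois_of_normalOver h hL) hp).2.1
    have hc : Nat.card (Multiplicative (A.obj F ⧸ A.normGroup h)) = degree h := hi
    have : Finite (Multiplicative (A.obj F ⧸ A.normGroup h)) :=
      Nat.finite_of_card_ne_zero (by rw [hc]; exact hp.ne_zero)
    apply Subgroup.eq_top_of_card_eq
    rw [hc, ← Subgroup.index_ker, hki]

end ClassValuation

/-! ### Surjectivity and kernel for general L/F -/

namespace MackeyFunctor

open FinExt

variable {k : Type u} {Ω : Type v} [Field k] [Field Ω] [Algebra k Ω]
  {A : MackeyFunctor.{u, v, w} k Ω} {F L M : FinExt k Ω} (h : F ≤ L)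

theorem normGroup_le (hFM : F ≤ M) (hML : M ≤ L) : A.normGroup h ≤ A.normGroup hFM := by
  rintro _ ⟨b, rfl⟩
  exact ⟨A.norm hML b, A.norm_norm _ _ _⟩

theorem norm_mem_normGroup (hFM : F ≤ M) (hML : M ≤ L) {a : A.obj M} (ha : a ∈ A.normGroup hML) :
    A.norm hFM a ∈ A.normGroup h := by
  obtain ⟨b, rfl⟩ := ha
  exact ⟨b, (A.norm_norm _ _ _).symm⟩

end MackeyFunctor

namespace ClassValuation

open FinExt ZHatExtension MackeyFunctor

variable {k : Type u} {Ω : Type v} [Field k] [Field Ω] [Algebra k Ω] [IsSepClosure k Ω]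
  {A : MackeyFunctor.{u, v, w} k Ω} {Z : ZHatExtension k Ω} (V : ClassValuation A Z)
  (hA3 : AxiomA3 A Z) {F L M : FinExt k Ω} (h : F ≤ L) (hL : F.NormalOver L)

/-- The norm of an element in the range of the reciprocity map is in the range. -/
theorem exists_recHom_eq_norm (hFM : F ≤ M) (hML : M ≤ L) {a : A.obj M}
    (ha : ∃ g, V.recHom hA3 hML (hL.of_le hFM) g = Multiplicative.ofAdd ↑a) :
    ∃ g, V.recHom hA3 h hL g = Multiplicative.ofAdd ↑(A.norm hFM a) := by
  obtain ⟨g, hg⟩ := ha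
  obtain ⟨b, hb, hb'⟩ := V.recHom_norm hA3 h hL hFM hML g
  refine ⟨_, hb'.trans ?_⟩
  rw [hg, Multiplicative.ofAdd.injective.eq_iff, QuotientAddGroup.eq] at hb
  rw [Multiplicative.ofAdd.injective.eq_iff, eq_comm, QuotientAddGroup.eq, ← map_neg, ← map_add]
  exact norm_mem_normGroup h hFM hML hb

/-- Modulo the image, every class in A_F is represented by a norm from M, and such norms are in the
image by norm compatibility. -/
theorem recHom_surjective_trans (hFM : F ≤ M) (hML : M ≤ L) (hM : F.NormalOver M)
    (h₁ : Function.Surjective (V.recHom hA3 hFM hM))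
    (h₂ : Function.Surjective (V.recHom hA3 hML (hL.of_le hFM))) :
    Function.Surjective (V.recHom hA3 h hL) := by
  intro x
  obtain ⟨a, rfl⟩ : ∃ a : A.obj F, Multiplicative.ofAdd (a : A.obj F ⧸ A.normGroup h) = x := by
    obtain ⟨a, ha⟩ := QuotientAddGroup.mk_surjective x.toAdd
    exact ⟨a, congrArg Multiplicative.ofAdd ha⟩
  obtain ⟨g, hg⟩ := h₁ (Multiplicative.ofAdd ↑a)
  obtain ⟨b, hb, hb'⟩ := V.recHom_of_le hA3 h hL hFM hML hM g
  rw [hg, Multiplicative.ofAdd.injective.eq_iff, eq_comm, QuotientAddGroup.eq] at hb'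
  obtain ⟨c, hc⟩ := hb'
  have hc : A.norm hFM c = -b + a := hc
  obtain ⟨g', hg'⟩ := V.exists_recHom_eq_norm hA3 h hL hFM hML (h₂ (Multiplicative.ofAdd ↑c))
  refine ⟨g * g', ?_⟩
  rw [map_mul, hb, hg', hc, ← ofAdd_add, ← QuotientAddGroup.mk_add, add_neg_cancel_left]

theorem recHom_surjective_of_prime_pow (hA4 : AxiomA4 A) {p : ℕ} (hp : p.Prime) (n : ℕ) :
    ∀ {F L : FinExt k Ω} (h : F ≤ L) (hL : F.NormalOver L), degree h = p ^ n →
      Function.Surjective (V.recHom hA3 h hL) := by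
  have : Fact p.Prime := ⟨hp⟩
  induction n with
  | zero =>
    intro F L h hL hd
    obtain rfl := eq_of_degree_eq_one h (by simpa using hd)
    intro x
    obtain ⟨a, ha⟩ := QuotientAddGroup.mk_surjective x.toAdd
    refine ⟨1, ?_⟩
    rw [map_one, eq_comm]
    have : x.toAdd = 0 := by
      rw [← ha, QuotientAddGroup.eq_zero_iff]
      exact ⟨a, A.norm_self _ a⟩
    exact this
  | succ n ih =>
    intro F L h hL hd
    have hfin := finite_galGroup h hL
    have hcard := (card_galGroup h hL).trans hd
    obtain ⟨Q, hQ⟩ := Sylow.exists_subgroup_card_pow_prime (G := GalGroup h) p (n := n)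
      (by rw [hcard]; exact pow_dvd_pow p n.le_succ)
    have hQi : Q.index = p := by
      have := Q.card_mul_index
      rw [hQ, hcard, pow_succ] at this
      exact Nat.eq_of_mul_eq_mul_left (pow_pos hp.pos n) this
    have hQn : Q.Normal := by
      apply Subgroup.normal_of_index_eq_minFac_card
      rw [hQi, hcard, hp.pow_minFac (Nat.succ_ne_zero n)]
    obtain ⟨M, hFM, hML, -, hdi, hdc, hMn⟩ := exists_finExt_of_subgroup h hL Q
    exact V.recHom_surjective_trans hA3 h hL hFM hML (hMn hQn)
      (V.recHom_of_prime hA3 hFM (hMn hQn) hA4 (by rw [hdi, hQi]; exact hp)).2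
      (ih hML _ (hdc.trans hQ))

/-- If p divided the order of x in the cokernel, take M fixed by a Sylow p-subgroup. Then |M:F|·a =
N(i(a)) is in the image by the p-power case over M, so that order divides |M:F|, which is prime to
p. -/
theorem recHom_surjective (hA4 : AxiomA4 A) : Function.Surjective (V.recHom hA3 h hL) := by
  have hfin := finite_galGroup h hL
  rw [← MonoidHom.range_eq_top, eq_top_iff]
  rintro x -
  rw [← QuotientGroup.eq_one_iff, ← orderOf_eq_one_iff, Nat.eq_one_iff_not_exists_prime_dvd]
  intro p hp hdvd
  have : Fact p.Prime := ⟨hp⟩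
  obtain ⟨P⟩ : Nonempty (Sylow p (GalGroup h)) := inferInstance
  obtain ⟨n, hn⟩ := IsPGroup.iff_card.1 P.2
  obtain ⟨M, hFM, hML, -, hdi, hdc, -⟩ := exists_finExt_of_subgroup h hL P
  refine P.not_dvd_index (hdvd.trans ?_)
  rw [orderOf_dvd_iff_pow_eq_one, ← QuotientGroup.mk_pow, QuotientGroup.eq_one_iff]
  obtain ⟨a, ha⟩ := QuotientAddGroup.mk_surjective x.toAdd
  obtain ⟨g, hg⟩ := V.exists_recHom_eq_norm hA3 h hL hFM hML (a := A.res hFM a)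
    (V.recHom_surjective_of_prime_pow hA3 hA4 hp n hML (hL.of_le hFM) (hdc.trans hn) _)
  refine ⟨g, hg.trans ?_⟩
  rw [A.norm_res, hdi, QuotientAddGroup.mk_nsmul, ofAdd_nsmul, ha]
  rfl

/-- Induction through M/F of prime degree. The prime case puts g in G_M; it remains to see that its
class b over M is trivial, knowing only that N_{M/F}b is a norm from L. -/
theorem mem_gal_of_recHom_eq_one_of_comm (hA4 : AxiomA4 A) (d : ℕ) :
    ∀ {F L : FinExt k Ω} (h : F ≤ L) (hL : F.NormalOver L), degree h = d →
      (∀ a ∈ F.gal, ∀ b ∈ F.gal, a * b * a⁻¹ * b⁻¹ ∈ L.gal) →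
      ∀ g, V.recHom hA3 h hL g = 1 → (g : Gal(Ω/k)) ∈ L.gal := by
  induction d using Nat.strong_induction_on with
  | _ d ih =>
  intro F L h hL hd hcomm g hg
  by_cases hd1 : d = 1
  · obtain rfl := eq_of_degree_eq_one h (hd.trans hd1)
    exact g.2
  have hfin := finite_galGroup h hL
  have hnt : Nontrivial (GalGroup h) := by
    rw [← Finite.one_lt_card_iff_nontrivial, card_galGroup h hL, hd]
    have := degree_pos h
    omega
  obtain ⟨Q, hQn, hQp⟩ := Subgroup.exists_normal_index_prime_of_comm (G := GalGroup h) (by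
    intro x y
    obtain ⟨a, rfl⟩ := resHom_surjective h hL x
    obtain ⟨b, rfl⟩ := resHom_surjective h hL y
    rw [← map_mul, ← map_mul, resHom_eq_iff]
    have := hcomm _ (inv_mem a.2) _ (inv_mem b.2)
    simpa [mul_assoc] using this)
  obtain ⟨M, hFM, hML, -, hdi, hdc, hMn⟩ := exists_finExt_of_subgroup h hL Q
  have hM := hMn hQn
  have hp : (degree hFM).Prime := by rwa [hdi]
  have hlt : degree hML < d := by
    rw [← hd, ← degree_mul_degree hFM hML]
    exact lt_mul_of_one_lt_left (degree_pos hML) hp.one_lt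
  have hpr := V.recHom_of_prime hA3 hFM hM hA4 hp
  have hgM : (g : Gal(Ω/k)) ∈ M.gal := by
    obtain ⟨a, ha, ha'⟩ := V.recHom_of_le hA3 h hL hFM hML hM g
    apply hpr.1
    rw [hg, ← ofAdd_zero, Multiplicative.ofAdd.injective.eq_iff, eq_comm,
      QuotientAddGroup.eq_zero_iff] at ha
    rw [ha', ← ofAdd_zero, Multiplicative.ofAdd.injective.eq_iff, QuotientAddGroup.eq_zero_iff]
    exact normGroup_le h hFM hML ha
  refine ih _ hlt hML (hL.of_le hFM) rfl
    (fun a ha b hb => hcomm a (gal_le hFM ha) b (gal_le hFM hb)) ⟨g, hgM⟩ ?_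
  obtain ⟨b, hb, hb'⟩ := V.recHom_norm hA3 h hL hFM hML ⟨g, hgM⟩
  have hb' : 1 = Multiplicative.ofAdd (A.norm hFM b : A.obj F ⧸ A.normGroup h) := hg.symm.trans hb'
  rw [← ofAdd_zero, Multiplicative.ofAdd.injective.eq_iff, eq_comm,
    QuotientAddGroup.eq_zero_iff] at hb'
  obtain ⟨c, hc⟩ := hb'
  have hc : A.norm h c = A.norm hFM b := hc
  have hker : A.norm hFM (b - A.norm hML c) = 0 := by
    rw [map_sub, A.norm_norm, hc, sub_self]
  obtain ⟨s, hsM⟩ : ∃ s : F.gal, (s : Gal(Ω/k)) ∉ M.gal := by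
    by_contra! hall
    have : degree hFM = 1 := by
      rw [degree_eq_relIndex, Subgroup.relIndex_eq_one]
      exact fun x hx => hall ⟨x, hx⟩
    exact hp.one_lt.ne' this
  have hgen := zpowers_resHom_eq_top hFM hM s
    fun g hg => exists_zpow_of_prime hFM hM hp s.2 hsM hg
  -- By Hilbert 90, b is (1-s)e up to a norm from L. Since e is a reciprocity value over M, s acts
  -- on its class through conjugation, which is trivial for abelian L/F.
  obtain ⟨e, he⟩ := ((hA4 F M hFM (isGalois_of_normalOver hFM hM) hp).1 _ hgen _).1 hker
  rw [A.oneSub_resHom] at he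
  obtain ⟨g₁, hg₁⟩ := V.recHom_surjective hA3 hML (hL.of_le hFM) hA4 (Multiplicative.ofAdd ↑e)
  have hconj : (s * g₁ * (s : Gal(Ω/k))⁻¹ : Gal(Ω/k)) ∈ M.gal := hM.conj_mem s.2 g₁.2
  obtain ⟨e', he', he''⟩ := V.recHom_conj hA3 hL hFM hML hM s g₁ (g' := ⟨_, hconj⟩) rfl
  have hsame : V.recHom hA3 hML (hL.of_le hFM) ⟨_, hconj⟩ =
      V.recHom hA3 hML (hL.of_le hFM) g₁ := by
    rw [← mul_inv_eq_one, ← map_inv, ← map_mul]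
    exact V.recHom_of_mem hA3 hML _ (hcomm _ s.2 _ (gal_le hFM g₁.2))
  rw [hsame, he', Multiplicative.ofAdd.injective.eq_iff, QuotientAddGroup.eq] at he''
  rw [hg₁, Multiplicative.ofAdd.injective.eq_iff, QuotientAddGroup.eq] at he'
  have hrep : A.rep hM s (-e + e') ∈ A.normGroup hML := by
    obtain ⟨y, hy⟩ := he'
    rw [← hy]
    exact ⟨A.rep hL s y, A.norm_rep hM hL hML s y⟩
  have hdiff : e - A.rep hM s e ∈ A.normGroup hML := by
    have h1 := sub_mem (sub_mem hrep he') he''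
    have h2 : A.rep hM s (-e + e') - (-e + e') - (-e' + A.rep hM s e') = e - A.rep hM s e := by
      rw [map_add, map_neg]
      abel
    rwa [h2] at h1
  rw [he] at hdiff
  have hbN : b ∈ A.normGroup hML := by
    have := add_mem hdiff (⟨c, rfl⟩ : A.norm hML c ∈ A.normGroup hML)
    rwa [sub_add_cancel] at this
  rw [hb, ← ofAdd_zero, Multiplicative.ofAdd.injective.eq_iff, QuotientAddGroup.eq_zero_iff]
  exact hbN

/-- Triviality passes to the fixed field of the commutator subgroup, where the abelian case applies.
-/
theorem resHom_mem_commutator_of_recHom_eq_one (hA4 : AxiomA4 A) {g : F.gal}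
    (hg : V.recHom hA3 h hL g = 1) : resHom h hL g ∈ commutator (GalGroup h) := by
  obtain ⟨M, hFM, hML, hmem, -, -, hMn⟩ :=
    exists_finExt_of_subgroup h hL (commutator (GalGroup h))
  have hM := hMn inferInstance
  rw [← hmem]
  refine V.mem_gal_of_recHom_eq_one_of_comm hA3 hA4 _ hFM hM rfl ?_ g ?_
  · intro a ha b hb
    let x : F.gal := ⟨a, ha⟩
    let y : F.gal := ⟨b, hb⟩
    have hxy : a * b * a⁻¹ * b⁻¹ = ((x * y * x⁻¹ * y⁻¹ : F.gal) : Gal(Ω/k)) := by simp [x, y]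
    rw [hxy, hmem, map_mul, map_mul, map_mul, map_inv, map_inv, ← commutatorElement_def]
    exact Subgroup.commutator_mem_commutator (Subgroup.mem_top _) (Subgroup.mem_top _)
  · obtain ⟨a, ha, ha'⟩ := V.recHom_of_le hA3 h hL hFM hML hM g
    rw [hg, ← ofAdd_zero, Multiplicative.ofAdd.injective.eq_iff, eq_comm,
      QuotientAddGroup.eq_zero_iff] at ha
    rw [ha', ← ofAdd_zero, Multiplicative.ofAdd.injective.eq_iff, QuotientAddGroup.eq_zero_iff]
    exact normGroup_le h hFM hML ha

/-- The reciprocity map `Gal(L/F) → A_F / N_{L/F} A_L`. -/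
noncomputable def recGal : GalGroup h →* Multiplicative (A.obj F ⧸ A.normGroup h) :=
  (resHom h hL).liftOfSurjective (resHom_surjective h hL) ⟨V.recHom hA3 h hL, by
    rw [ker_resHom]
    exact fun g hg => V.recHom_of_mem hA3 h hL hg⟩

theorem recGal_resHom (g : F.gal) : V.recGal hA3 h hL (resHom h hL g) = V.recHom hA3 h hL g :=
  (resHom h hL).liftOfRightInverse_comp_apply _ _ _ g

theorem isReciprocityMap_recGal :
    V.IsReciprocityMap h fun σ => Multiplicative.toAdd (V.recGal hA3 h hL σ) := by
  intro σ
  constructor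
  · obtain ⟨g, rfl⟩ := resHom_surjective h hL σ
    obtain ⟨τ, n, hτ, hgτ⟩ := exists_isFrobLift (Z := Z) h hL g.2
    exact ⟨τ, n, hτ.pos, (extends_iff h hL).2 ⟨hτ.mem, (resHom_eq_iff h hL).2 hgτ⟩,
      (isFrobLift_iff.1 hτ).2⟩
  · intro τ i hi hτσ hτi
    have hτ : Z.IsFrobLift F τ i := isFrobLift_iff.2 ⟨hi, hτi⟩
    obtain ⟨S, hS, hf⟩ := hτ.exists_fixedIn h hL
    obtain ⟨hτF, rfl⟩ := (extends_iff h hL).1 hτσ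
    refine ⟨S, hS, hf, V.exists_isPrimeElement S, fun ϖ hϖ => ?_⟩
    change Multiplicative.toAdd (V.recGal hA3 h hL _) = _
    rw [recGal_resHom, V.recHom_eq hA3 h hL hτ (by simp), toAdd_ofAdd,
      V.frobNorm_eq hA3 h hL hτ hS hf hϖ]

theorem bijective_lift_recGal (hA4 : AxiomA4 A) :
    Function.Bijective (Abelianization.lift (V.recGal hA3 h hL)) := by
  constructor
  · rw [injective_iff_map_eq_one]
    intro x hx
    obtain ⟨σ, rfl⟩ : ∃ σ, Abelianization.of σ = x := QuotientGroup.mk_surjective x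
    obtain ⟨g, rfl⟩ := resHom_surjective h hL σ
    rw [Abelianization.lift_apply_of, recGal_resHom] at hx
    rw [← MonoidHom.mem_ker, Abelianization.ker_of]
    exact V.resHom_mem_commutator_of_recHom_eq_one hA3 h hL hA4 hx
  · intro y
    obtain ⟨g, hg⟩ := V.recHom_surjective hA3 h hL hA4 y
    exact ⟨Abelianization.of (resHom h hL g), by
      rw [Abelianization.lift_apply_of, recGal_resHom, hg]⟩

end ClassValuation

theorem mainTheorem4 {k : Type u} {Ω : Type v} [Field k] [Field Ω] [Algebra k Ω]
    [IsSepClosure k Ω] (A : MackeyFunctor.{u, v, w} k Ω) (Z : ZHatExtension k Ω)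
    (V : ClassValuation A Z) (hA3 : AxiomA3 A Z)
    (F L : FinExt k Ω) (h : F ≤ L) (hGal : IsGalois F.1 (FinExt.relExt h)) :
    ∃ Υ : FinExt.GalGroup h →* Multiplicative (A.obj F ⧸ A.normGroup h),
      V.IsReciprocityMap h (fun σ => Multiplicative.toAdd (Υ σ)) ∧
      (AxiomA4 A → Function.Bijective (Abelianization.lift Υ)) := by
  have hL := FinExt.normalOver_of_isGalois h hGal
  exact ⟨V.recGal hA3 h hL, V.isReciprocityMap_recGal hA3 h hL,
    V.bijective_lift_recGal hA3 h hL⟩
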